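/- Let $d\in\mathbb N$, $d\ge 1$, $1\le p\le\infty$ and $r>1/p$ (with $1/\infty=0$). Let $\mathbb T^d=(\mathbb R/2\pi\mathbb Z)^d$ with the normalized measure $(2\pi)^{-d}d\mathbf x$, and let $\|\cdot\|_p$ be the norm of the complex space $L_p(\mathbb T^d)$ with respect to it. For $B>0$ consider the following two (equivalent) definitions of the class $\mathbf H^r_pB$. (i) Put $l=[r]+1$. For $\mathbf t\in\mathbb R^d$ and $e\subset\{1,\dots,d\}$ let $\Delta^l_{\mathbf t}(e)=\prod_{j\in e}\Delta^l_{t_j,j}$, where $\Delta^l_{t,j}$ is the $l$-th difference with step $t$ in the variable $x_j$, and $\Delta^l_{\mathbf t}(\varnothing)=I$. Then $\mathbf H^r_pB$ is the set of all $f\in L_p(\mathbb T^d)$ such that $$\|\Delta^l_{\mathbf t}(e)f\|_p\le B\prod_{j\in e}|t_j|^r\qquad\text{for all } e\subset\{1,\dots,d\},\ \mathbf t\in\mathbb R^d.$$ (ii) Let $\mathcal D_j(x)=\sum_{|k|\le j}e^{ikx}$, $\mathcal V_j=j^{-1}\sum_{l=j}^{2j-1}\mathcal D_l$ for $j\ge1$,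 $\mathcal A_0=1$, $\mathcal A_1=\mathcal V_1-1$, $\mathcal A_s=\mathcal V_{2^{s-1}}-\mathcal V_{2^{s-2}}$ for $s\ge2$. For $\mathbf s\in\mathbb N_0^d$ let $\mathcal A_{\mathbf s}(\mathbf x)=\prod_{j=1}^d\mathcal A_{s_j}(x_j)$ and $A_{\mathbf s}(f)(\mathbf x)=(2\pi)^{-d}\int_{\mathbb T^d}f(\mathbf y)\mathcal A_{\mathbf s}(\mathbf x-\mathbf y)\,d\mathbf y$. Then $\mathbf H^r_pB$ is the set of all $f\in L_p(\mathbb T^d)$ such that $$\|A_{\mathbf s}(f)\|_p\le B\,2^{-r(s_1+\dots+s_d)}\qquad\text{for all }\mathbf s\in\mathbb N_0^d.$$ Write $\mathbf H^r_p$ for $\mathbf H^r_pB$ with $B=1$. Then, for each of the definitions (i) and (ii), there is a constant $B=B(d,r,p)>0$ such that $fg\in\mathbf H^r_pB$ for all $f,g\in\mathbf H^r_p$. Consequently $\mathbf H^r_p$ has the quasi-algebra property with parameter $B$: $fg/B\in\mathbf H^r_p$ for all $f,g\in\mathbf H^r_p$. -/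

import Mathlib

open MeasureTheory
open scoped ENNReal Real

noncomputable section

namespace MixedSmoothness

instance fact_two_pi_pos : Fact ((0 : ℝ) < 2 * π) := ⟨Real.two_pi_pos⟩

/-- The torus `𝕋^d = (ℝ / 2πℤ)^d`; functions on it are the `2π`-periodic functions of
`d` real variables. -/
abbrev Torus (d : ℕ) : Type := Fin d → AddCircle (2 * π)

/-- The normalized Lebesgue measure `(2π)^{-d} d𝐱` on `𝕋^d`, a probability measure. -/
def torusMeasure (d : ℕ) : Measure (Torus d) :=
  Measure.pi fun _ => AddCircle.haarAddCircle

/-! ### The classes defined by mixed differences -/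

/-- `Δ_{t,j}^l f`, the `l`-th difference of `f` with step `t` in the variable `x_j`
(the `l`-th iterate of `f ↦ f(𝐱 + t e_j) - f(𝐱)`). -/
def partialDiff {d : ℕ} (l : ℕ) (t : ℝ) (j : Fin d) (f : Torus d → ℂ) : Torus d → ℂ :=
  (fwdDiff (Pi.single j (t : AddCircle (2 * π)) : Torus d))^[l] f

/-- `Δ_𝐭^l(e) f`, the composition of the operators `Δ_{t_j,j}^l` over `j ∈ e`, where smaller `j`
are applied first. For `e = ∅` this is `f`. -/
def mixedDiff {d : ℕ} (l : ℕ) (t : Fin d → ℝ) (e : Finset (Fin d)) (f : Torus d → ℂ) :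
    Torus d → ℂ :=
  ((List.finRange d).filter (· ∈ e)).foldl (fun g j => partialDiff l (t j) j g) f

/-- The class `𝐇^r_{p,l} B` of all `f ∈ L_p(𝕋^d)` such that
`‖Δ_𝐭^l(e) f‖_p ≤ B ∏_{j ∈ e} |t_j|^r` for all `e ⊆ {1, …, d}` and all `𝐭 ∈ ℝ^d`. -/
def hClassOrder (d : ℕ) (r : ℝ) (p : ℝ≥0∞) (l : ℕ) (B : ℝ) : Set (Torus d → ℂ) :=
  {f | MemLp f p (torusMeasure d) ∧
    ∀ (e : Finset (Fin d)) (t : Fin d → ℝ),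
      eLpNorm (mixedDiff l t e f) p (torusMeasure d) ≤
        ENNReal.ofReal (B * ∏ j ∈ e, |t j| ^ r)}

/-- The class `𝐇^r_p B`, i.e. `𝐇^r_{p,l} B` with `l = [r] + 1`. -/
def hClass (d : ℕ) (r : ℝ) (p : ℝ≥0∞) (B : ℝ) : Set (Torus d → ℂ) :=
  hClassOrder d r p (⌊r⌋₊ + 1) B

/-! ### The classes defined by de la Vallée Poussin dyadic blocks -/

/-- The Dirichlet kernel `𝒟_j(x) = ∑_{|k| ≤ j} e^{ikx}`. -/
def dirichletKernel (j : ℕ) (x : AddCircle (2 * π)) : ℂ :=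
  ∑ k ∈ Finset.Icc (-(j : ℤ)) (j : ℤ), fourier k x

/-- The de la Vallée Poussin kernel `𝒱_j = j⁻¹ ∑_{l=j}^{2j-1} 𝒟_l` (used for `j ≥ 1`). -/
def vallePoussinKernel (j : ℕ) (x : AddCircle (2 * π)) : ℂ :=
  (j : ℂ)⁻¹ * ∑ l ∈ Finset.Ico j (2 * j), dirichletKernel l x

/-- `𝒜_0 = 1`, `𝒜_1 = 𝒱_1 - 1`, `𝒜_s = 𝒱_{2^{s-1}} - 𝒱_{2^{s-2}}` for `s ≥ 2`. -/
def blockKernel : ℕ → AddCircle (2 * π) → ℂ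
  | 0, _ => 1
  | 1, x => vallePoussinKernel 1 x - 1
  | s + 2, x => vallePoussinKernel (2 ^ (s + 1)) x - vallePoussinKernel (2 ^ s) x

/-- `A_𝐬(f)(𝐱) = (2π)^{-d} ∫ f(𝐲) 𝒜_𝐬(𝐱 - 𝐲) d𝐲` with
`𝒜_𝐬(𝐱) = 𝒜_{s_1}(x_1) ⋯ 𝒜_{s_d}(x_d)`. -/
def block {d : ℕ} (s : Fin d → ℕ) (f : Torus d → ℂ) (x : Torus d) : ℂ :=
  ∫ y, f y * ∏ j, blockKernel (s j) (x j - y j) ∂(torusMeasure d)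

/-- The class of all `f ∈ L_p(𝕋^d)` with `‖A_𝐬(f)‖_p ≤ B 2^{-r(s_1 + ⋯ + s_d)}` for all
`𝐬 ∈ ℕ₀^d`. -/
def hBlockClass (d : ℕ) (r : ℝ) (p : ℝ≥0∞) (B : ℝ) : Set (Torus d → ℂ) :=
  {f | MemLp f p (torusMeasure d) ∧
    ∀ s : Fin d → ℕ,
      eLpNorm (block s f) p (torusMeasure d) ≤
        ENNReal.ofReal (B * (2 : ℝ) ^ (-r * ∑ j, (s j : ℝ)))}

/-- A function class `W` has the quasi-algebra property with parameter `a` if `fg / a ∈ W` for all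
`f, g ∈ W`. -/
def QuasiAlgebraWith {X : Type*} (W : Set (X → ℂ)) (a : ℝ) : Prop :=
  ∀ f ∈ W, ∀ g ∈ W, (fun x => f x * g x / (a : ℂ)) ∈ W

end MixedSmoothness

end

/-!
Write `ρ = 1 / p`. In each variable `A_𝐬 f` is the convolution of `f` with a trigonometric
polynomial of degree at most `2 ^ s` whose coefficients form a Lipschitz symbol at scale `2 ^ s`; a
weighted `L₂` estimate bounds the `L₁` norm of such a polynomial independently of `s`. Hence the two
definitions are comparable: for `s ≥ 1`, `𝒜_s` is an `l`-th difference with step `2 ^ (-s)` of a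
kernel of bounded `L₁` norm (Jackson), while an `l`-th difference with step `t` of a block gains a
factor `min 1 (2 ^ s |t|) ^ l` (Bernstein), and `∑_s 2 ^ (-r s) min 1 (2 ^ s |t|) ^ l ≲ |t| ^ r` for
`0 < r < l`.

It then suffices to estimate products in terms of blocks. The block `A_𝐮 (A_𝐬 f * A_𝐬' g)` vanishes
unless `u_j ≤ max s_j s'_j + 2` for all `j`. Nikol'skii's inequality, applied in each variable to
the factor of lower degree there, bounds the `L_p` norm of `A_𝐬 f * A_𝐬' g` by
`∏_j 2 ^ (ρ min s_j s'_j)` times the product of the `L_p` norms of the factors, up to a constant.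
Since `r > ρ`, the sum over all such `𝐬`, `𝐬'` is a product of convergent geometric sums, of order
`∏_j 2 ^ (-r u_j)`.
-/

open scoped Convolution

noncomputable section

namespace MixedSmoothness

/-! ### Trigonometric polynomials on the circle -/

lemma integrable_of_continuous {X E : Type*} [TopologicalSpace X] [CompactSpace X]
    [MeasurableSpace X] [OpensMeasurableSpace X] {μ : Measure X} [IsFiniteMeasureOnCompacts μ]
    [NormedAddCommGroup E] {f : X → E} (hf : Continuous f) : Integrable f μ :=
  hf.integrable_of_hasCompactSupport (HasCompactSupport.of_compactSpace f)

section Circle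

variable {T : ℝ}

lemma norm_fourier_apply (k : ℤ) (x : AddCircle T) : ‖fourier k x‖ = 1 := by
  rw [fourier_apply]
  exact Circle.norm_coe _

lemma fourier_apply_add (k : ℤ) (x y : AddCircle T) :
    fourier k (x + y) = fourier k x * fourier k y := by
  simp [fourier_apply, smul_add, AddCircle.toCircle_add]

lemma fourier_apply_sub (k : ℤ) (x y : AddCircle T) :
    fourier k (x - y) = fourier k x * fourier (-k) y := by
  rw [sub_eq_add_neg, fourier_apply_add]
  simp [fourier_apply]

lemma norm_fourier_sub_fourier_pred (k : ℤ) (x : AddCircle T) :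
    ‖fourier k x - fourier (k - 1) x‖ = ‖fourier 1 x - 1‖ := by
  have h : fourier k x = fourier (k - 1) x * fourier 1 x := by
    rw [← fourier_add, sub_add_cancel]
  rw [h, ← mul_sub_one, norm_mul, norm_fourier_apply, one_mul]

lemma fourier_coe_eq_exp (k : ℤ) (t : ℝ) :
    fourier k (t : AddCircle T) = Complex.exp (Complex.I * ((2 * π / T * (k * t) : ℝ) : ℂ)) := by
  rw [fourier_coe_apply]
  congr 1
  push_cast
  ring

lemma norm_fourier_coe_sub_one_le (k : ℤ) (t : ℝ) :
    ‖fourier k (t : AddCircle T) - 1‖ ≤ |2 * π / T * (k * t)| := by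
  rw [fourier_coe_eq_exp]
  exact Real.norm_exp_I_mul_ofReal_sub_one_le

lemma two_div_pi_mul_abs_le_norm_exp_sub_one {x : ℝ} (hx : |x| ≤ π) :
    2 / π * |x| ≤ ‖Complex.exp (Complex.I * x) - 1‖ := by
  have hsin := Real.mul_abs_le_abs_sin (x := x / 2) (by rw [abs_div, abs_two]; linarith)
  rw [abs_div, abs_two] at hsin
  rw [Complex.norm_exp_I_mul_ofReal_sub_one, norm_mul, Real.norm_eq_abs, Real.norm_eq_abs, abs_two]
  linarith

lemma two_div_pi_mul_abs_le_norm_fourier_coe_sub_one {k : ℤ} {t : ℝ}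
    (h : |2 * π / T * (k * t)| ≤ π) :
    2 / π * |2 * π / T * (k * t)| ≤ ‖fourier k (t : AddCircle T) - 1‖ := by
  rw [fourier_coe_eq_exp]
  exact two_div_pi_mul_abs_le_norm_exp_sub_one h

/-- The trigonometric polynomial of degree at most `n` with coefficients `a k`; the values of `a`
at frequencies `|k| > n` are ignored. -/
def trigPoly (n : ℕ) (a : ℤ → ℂ) (x : AddCircle T) : ℂ :=
  ∑ k ∈ Finset.Icc (-(n : ℤ)) (n : ℤ), a k * fourier k x

@[fun_prop]
lemma continuous_trigPoly (n : ℕ) (a : ℤ → ℂ) : Continuous (trigPoly (T := T) n a) := by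
  unfold trigPoly
  fun_prop

lemma trigPoly_congr {n : ℕ} {a b : ℤ → ℂ} (h : ∀ k : ℤ, |k| ≤ n → a k = b k) :
    trigPoly (T := T) n a = trigPoly n b := by
  ext x
  refine Finset.sum_congr rfl fun k hk => ?_
  rw [h k (abs_le.2 (Finset.mem_Icc.1 hk))]

lemma trigPoly_eq_of_le {n m : ℕ} (hnm : n ≤ m) {a : ℤ → ℂ}
    (ha : ∀ k : ℤ, (n : ℤ) < |k| → a k = 0) : trigPoly (T := T) n a = trigPoly m a := by
  ext x
  refine Finset.sum_subset (Finset.Icc_subset_Icc (by lia) (by lia)) fun k _ hk => ?_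
  rw [Finset.mem_Icc, ← abs_le, not_le] at hk
  rw [ha k hk, zero_mul]

lemma trigPoly_sub (n : ℕ) (a b : ℤ → ℂ) :
    trigPoly (T := T) n (a - b) = trigPoly n a - trigPoly n b := by
  ext x
  simp [trigPoly, sub_mul]

lemma enorm_trigPoly_le {n : ℕ} {a : ℤ → ℂ} (ha : ∀ k, ‖a k‖ ≤ 1) (x : AddCircle T) :
    ‖trigPoly n a x‖ₑ ≤ 2 * n + 1 := by
  have hcard : (Finset.Icc (-(n : ℤ)) n).card = 2 * n + 1 := by rw [Int.card_Icc]; lia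
  calc ‖trigPoly n a x‖ₑ
      ≤ ∑ k ∈ Finset.Icc (-(n : ℤ)) n, ‖a k * fourier k x‖ₑ := enorm_sum_le _ _
    _ ≤ ∑ _k ∈ Finset.Icc (-(n : ℤ)) n, 1 := by
        refine Finset.sum_le_sum fun k _ => ?_
        rw [← ofReal_norm, norm_mul, norm_fourier_apply, mul_one]
        exact ENNReal.ofReal_le_one.2 (ha k)
    _ = 2 * n + 1 := by rw [Finset.sum_const, hcard]; simp

lemma fwdDiff_trigPoly (n : ℕ) (a : ℤ → ℂ) (t : AddCircle T) :
    fwdDiff t (trigPoly n a) = trigPoly n fun k => (fourier k t - 1) * a k := by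
  ext x
  simp only [fwdDiff, trigPoly, ← Finset.sum_sub_distrib]
  refine Finset.sum_congr rfl fun k _ => ?_
  rw [fourier_apply_add]
  ring

lemma iterate_fwdDiff_trigPoly (n : ℕ) (a : ℤ → ℂ) (t : AddCircle T) (l : ℕ) :
    (fwdDiff t)^[l] (trigPoly n a) = trigPoly n fun k => (fourier k t - 1) ^ l * a k := by
  induction l with
  | zero => simp
  | succ l ih =>
    rw [Function.iterate_succ_apply', ih, fwdDiff_trigPoly]
    congr 1
    ext k
    ring

/-- The coefficient sequences `a` which, rescaled to `ξ ↦ a (n ξ)`, vanish for `|ξ| ≥ 1`, are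
bounded by `M` and are `M`-Lipschitz. The `L₁` norm of the corresponding kernel is controlled by
`M` alone. -/
structure LipschitzSymbol (n : ℕ) (M : ℝ) (a : ℤ → ℂ) : Prop where
  eq_zero_of_le : ∀ k : ℤ, (n : ℤ) ≤ |k| → a k = 0
  norm_le : ∀ k, ‖a k‖ ≤ M
  norm_sub_le : ∀ k, ‖a k - a (k - 1)‖ ≤ M / n

namespace LipschitzSymbol

variable {n : ℕ} {M : ℝ} {a : ℤ → ℂ}

lemma nonneg (h : LipschitzSymbol n M a) : 0 ≤ M := (norm_nonneg _).trans (h.norm_le 0)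

lemma abs_le_of_ne_zero (h : LipschitzSymbol n M a) {k : ℤ} (hk : a k ≠ 0) : |k| ≤ n :=
  le_of_not_ge fun hnk => hk (h.eq_zero_of_le k hnk)

lemma mono {N : ℝ} (h : LipschitzSymbol n M a) (hMN : M ≤ N) : LipschitzSymbol n N a where
  eq_zero_of_le := h.eq_zero_of_le
  norm_le k := (h.norm_le k).trans hMN
  norm_sub_le k := (h.norm_sub_le k).trans (by gcongr)

lemma sub {N : ℝ} {b : ℤ → ℂ} (ha : LipschitzSymbol n M a) (hb : LipschitzSymbol n N b) :
    LipschitzSymbol n (M + N) (a - b) where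
  eq_zero_of_le k hk := by simp [ha.eq_zero_of_le k hk, hb.eq_zero_of_le k hk]
  norm_le k := (_root_.norm_sub_le _ _).trans (add_le_add (ha.norm_le k) (hb.norm_le k))
  norm_sub_le k := by
    rw [add_div, Pi.sub_apply, Pi.sub_apply, sub_sub_sub_comm]
    exact (_root_.norm_sub_le _ _).trans (add_le_add (ha.norm_sub_le k) (hb.norm_sub_le k))

lemma two_mul (h : LipschitzSymbol n M a) : LipschitzSymbol (2 * n) (2 * M) a where
  eq_zero_of_le k hk := h.eq_zero_of_le k (by push_cast at hk; lia)
  norm_le k := (h.norm_le k).trans (by linarith [h.nonneg])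
  norm_sub_le k := by
    push_cast
    rw [mul_div_mul_left _ _ two_ne_zero]
    exact h.norm_sub_le k

lemma mul {z : ℤ → ℂ} {C D : ℝ} (h : LipschitzSymbol n M a) (hC : 0 ≤ C) (hD : 0 ≤ D)
    (hz : ∀ k, a k ≠ 0 → ‖z k‖ ≤ C)
    (hz' : ∀ k, a k ≠ 0 → a (k - 1) ≠ 0 → ‖z k - z (k - 1)‖ ≤ D / n) :
    LipschitzSymbol n ((C + D) * M) fun k => z k * a k where
  eq_zero_of_le k hk := by rw [h.eq_zero_of_le k hk, mul_zero]
  norm_le k := by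
    have hM := h.nonneg
    by_cases ha : a k = 0
    · rw [ha, mul_zero, norm_zero]
      positivity
    · rw [norm_mul]
      gcongr
      exacts [(hz k ha).trans (by linarith), h.norm_le k]
  norm_sub_le k := by
    have hM := h.nonneg
    have hCM : C * (M / n) ≤ (C + D) * M / n := by
      rw [← mul_div_assoc]
      gcongr
      linarith
    by_cases ha : a k = 0
    · by_cases ha' : a (k - 1) = 0
      · rw [ha, ha', mul_zero, mul_zero, sub_zero, norm_zero]
        positivity
      · calc ‖z k * a k - z (k - 1) * a (k - 1)‖ = ‖z (k - 1)‖ * ‖a k - a (k - 1)‖ := by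
              rw [ha, mul_zero, zero_sub, zero_sub, norm_neg, norm_neg, norm_mul]
          _ ≤ C * (M / n) := by gcongr; exacts [hz _ ha', h.norm_sub_le k]
          _ ≤ (C + D) * M / n := hCM
    · have split : z k * a k - z (k - 1) * a (k - 1) =
          z k * (a k - a (k - 1)) + (z k - z (k - 1)) * a (k - 1) := by ring
      by_cases ha' : a (k - 1) = 0
      · rw [split, ha', mul_zero, add_zero, sub_zero, norm_mul]
        refine (mul_le_mul (hz k ha) ?_ (norm_nonneg _) hC).trans hCM
        simpa [ha'] using h.norm_sub_le k
      · calc ‖z k * a k - z (k - 1) * a (k - 1)‖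
            ≤ ‖z k‖ * ‖a k - a (k - 1)‖ + ‖z k - z (k - 1)‖ * ‖a (k - 1)‖ := by
              rw [split, ← norm_mul, ← norm_mul]
              exact norm_add_le _ _
          _ ≤ C * (M / n) + D / n * M := by
              gcongr
              exacts [hz k ha, h.norm_sub_le k, hz' k ha ha', h.norm_le _]
          _ = (C + D) * M / n := by ring

lemma pow_mul {z : ℤ → ℂ} {C D : ℝ} (h : LipschitzSymbol n M a) (hC : 0 ≤ C) (hD : 0 ≤ D)
    (hz : ∀ k, a k ≠ 0 → ‖z k‖ ≤ C)
    (hz' : ∀ k, a k ≠ 0 → a (k - 1) ≠ 0 → ‖z k - z (k - 1)‖ ≤ D / n) (l : ℕ) :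
    LipschitzSymbol n ((C + D) ^ l * M) fun k => z k ^ l * a k := by
  induction l with
  | zero => simpa using h
  | succ l ih =>
    have := ih.mul hC hD (fun k hk => hz k (right_ne_zero_of_mul hk))
      fun k hk hk' => hz' k (right_ne_zero_of_mul hk) (right_ne_zero_of_mul hk')
    simpa only [pow_succ', mul_assoc] using this

lemma fourier_one_sub_one_mul_trigPoly (h : LipschitzSymbol n M a) (x : AddCircle T) :
    (fourier 1 x - 1) * trigPoly n a x = trigPoly n (fun k => a (k - 1) - a k) x := by
  have tsum_eq {b : ℤ → ℂ} (hb : ∀ k : ℤ, n < |k| → b k = 0) :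
      ∑' k, b k * fourier k x = trigPoly n b x :=
    tsum_eq_sum fun k hk => by
      rw [hb k (not_le.1 fun hk' => hk (Finset.mem_Icc.2 (abs_le.1 hk'))), zero_mul]
  have shift : fourier 1 x * trigPoly n a x = trigPoly n (fun k => a (k - 1)) x := by
    have hpred (k : ℤ) (hk : n < |k|) : a (k - 1) = 0 :=
      h.eq_zero_of_le (k - 1) (by rw [le_abs]; rw [lt_abs] at hk; lia)
    rw [← tsum_eq fun k hk => h.eq_zero_of_le k hk.le, ← tsum_eq hpred, ← tsum_mul_left,
      ← (Equiv.addRight (1 : ℤ)).tsum_eq fun k => a (k - 1) * fourier k x]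
    refine tsum_congr fun k => ?_
    simp only [Equiv.coe_addRight, add_sub_cancel_right, fourier_add]
    ring
  rw [sub_mul, one_mul, shift]
  exact (congrFun (trigPoly_sub n _ a) x).symm

end LipschitzSymbol

/-- The weight `1 + (n |x|)²`, up to constants. A kernel concentrated near `0` at scale `1 / n` has
`L₁` norm controlled by its `L₂` norm with this weight. -/
def weight (n : ℕ) (x : AddCircle T) : ℝ := 1 + n ^ 2 * ‖fourier 1 x - 1‖ ^ 2

@[fun_prop]
lemma continuous_weight (n : ℕ) : Continuous (weight (T := T) n) := by
  unfold weight
  fun_prop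

lemma weight_pos (n : ℕ) (x : AddCircle T) : 0 < weight n x := by
  unfold weight
  positivity

variable [hT : Fact (0 < T)]

lemma integral_fourier (n : ℤ) :
    ∫ x : AddCircle T, fourier n x ∂AddCircle.haarAddCircle = if n = 0 then 1 else 0 := by
  have h := congrFun (fourierCoeff_fourier (T := T) n) 0
  simpa [fourierCoeff, Pi.single_apply, eq_comm] using h

lemma integral_norm_sq_sum_fourier (S : Finset ℤ) (c : ℤ → ℂ) :
    ∫ x : AddCircle T, ‖∑ k ∈ S, c k * fourier k x‖ ^ 2 ∂AddCircle.haarAddCircle =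
      ∑ k ∈ S, ‖c k‖ ^ 2 := by
  have expand (x : AddCircle T) : ((‖∑ k ∈ S, c k * fourier k x‖ ^ 2 : ℝ) : ℂ) =
      ∑ k ∈ S, ∑ l ∈ S, (c k * (starRingEnd ℂ) (c l)) * fourier (k - l) x := by
    rw [Complex.ofReal_pow, ← Complex.mul_conj', map_sum, Finset.sum_mul_sum]
    refine Finset.sum_congr rfl fun k _ => Finset.sum_congr rfl fun l _ => ?_
    rw [map_mul, ← fourier_neg, sub_eq_add_neg, fourier_add]
    ring
  apply Complex.ofReal_injective
  rw [← integral_complex_ofReal]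
  simp_rw [expand]
  rw [integral_finsetSum _ fun k _ => integrable_of_continuous (by fun_prop)]
  push_cast
  refine Finset.sum_congr rfl fun k hk => ?_
  rw [integral_finsetSum _ fun k _ => integrable_of_continuous (by fun_prop)]
  simp_rw [integral_const_mul, integral_fourier, sub_eq_zero]
  simp [hk, Complex.mul_conj']

lemma integral_norm_sq_trigPoly_le {n : ℕ} {a : ℤ → ℂ} {M : ℝ} (ha : ∀ k, ‖a k‖ ≤ M) :
    ∫ x : AddCircle T, ‖trigPoly n a x‖ ^ 2 ∂AddCircle.haarAddCircle ≤ (2 * n + 1) * M ^ 2 := by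
  have hcard : (Finset.Icc (-(n : ℤ)) n).card = 2 * n + 1 := by rw [Int.card_Icc]; lia
  unfold trigPoly
  rw [integral_norm_sq_sum_fourier]
  calc ∑ k ∈ Finset.Icc (-(n : ℤ)) n, ‖a k‖ ^ 2
      ≤ ∑ _k ∈ Finset.Icc (-(n : ℤ)) n, M ^ 2 :=
        Finset.sum_le_sum fun k _ => pow_le_pow_left₀ (norm_nonneg _) (ha k) 2
    _ = (2 * n + 1) * M ^ 2 := by rw [Finset.sum_const, hcard]; simp

lemma integral_fourier_mul_trigPoly {n : ℕ} {a : ℤ → ℂ} {k : ℤ}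
    (hk : a k ≠ 0 → |k| ≤ n) (x : AddCircle T) :
    ∫ y, fourier k y * trigPoly n a (x - y) ∂AddCircle.haarAddCircle = a k * fourier k x := by
  have expand (y : AddCircle T) : fourier k y * trigPoly n a (x - y) =
      ∑ m ∈ Finset.Icc (-(n : ℤ)) (n : ℤ), a m * fourier m x * fourier (k - m) y := by
    rw [trigPoly, Finset.mul_sum]
    refine Finset.sum_congr rfl fun m _ => ?_
    rw [fourier_apply_sub, sub_eq_add_neg k, fourier_add]
    ring
  simp_rw [expand]
  rw [integral_finsetSum _ fun m _ => integrable_of_continuous (by fun_prop)]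
  simp_rw [integral_const_mul, integral_fourier, sub_eq_zero]
  simp only [mul_ite, mul_one, mul_zero, Finset.sum_ite_eq, Finset.mem_Icc, ← abs_le]
  split_ifs with h
  · rfl
  · rw [not_imp_comm.1 hk h, zero_mul]

lemma integral_trigPoly_mul_trigPoly (n : ℕ) (a c : ℤ → ℂ) (x : AddCircle T) :
    ∫ y, trigPoly n c y * trigPoly n a (x - y) ∂AddCircle.haarAddCircle =
      trigPoly n (fun k => a k * c k) x := by
  simp_rw [trigPoly.eq_1 n c, Finset.sum_mul, mul_assoc]
  rw [integral_finsetSum _ fun m _ => integrable_of_continuous (by fun_prop)]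
  refine Finset.sum_congr rfl fun k hk => ?_
  rw [integral_const_mul, integral_fourier_mul_trigPoly fun _ => abs_le.2 (Finset.mem_Icc.1 hk)]
  ring

lemma integral_div_weight_le (n : ℕ) :
    ∫ x : AddCircle T, n / weight n x ∂AddCircle.haarAddCircle ≤ 1 := by
  rcases n.eq_zero_or_pos with rfl | hn
  · simp
  have hT' : 0 < T := hT.out
  have hω : 0 < 2 * π / T := by positivity
  have hcont : Continuous fun a : ℝ => n / weight n (a : AddCircle T) :=
    continuous_const.div ((continuous_weight n).comp (AddCircle.continuous_mk' _))
      fun a => (weight_pos n _).ne'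
  have hint : Integrable fun a : ℝ => (n : ℝ) * (1 + (4 * n / T * a) ^ 2)⁻¹ :=
    (integrable_inv_one_add_sq.comp_mul_left' (by positivity)).const_mul _
  have hpt (a : ℝ) (ha : a ∈ Set.Ioc (-(T / 2)) (-(T / 2) + T)) :
      n / weight n (a : AddCircle T) ≤ n * (1 + (4 * n / T * a) ^ 2)⁻¹ := by
    have habs : |a| ≤ T / 2 := abs_le.2 ⟨ha.1.le, by linarith [ha.2]⟩
    have hlow : 4 / T * |a| ≤ ‖fourier 1 (a : AddCircle T) - 1‖ := by
      have hle : |2 * π / T * ((1 : ℤ) * a)| ≤ π := by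
        rw [Int.cast_one, one_mul, abs_mul, abs_of_pos hω, div_mul_eq_mul_div, div_le_iff₀ hT']
        nlinarith [Real.pi_pos]
      refine le_trans (le_of_eq ?_) (two_div_pi_mul_abs_le_norm_fourier_coe_sub_one hle)
      rw [Int.cast_one, one_mul, abs_mul, abs_of_pos hω]
      field_simp
      ring
    rw [div_eq_mul_inv]
    gcongr
    calc 1 + (4 * n / T * a) ^ 2 = 1 + n ^ 2 * (4 / T * |a|) ^ 2 := by
          rw [mul_pow _ |a|, sq_abs]
          ring
      _ ≤ weight n (a : AddCircle T) := by
          unfold weight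
          gcongr
  rw [AddCircle.integral_haarAddCircle, ← AddCircle.integral_preimage T (-(T / 2)), smul_eq_mul]
  calc T⁻¹ * ∫ a in Set.Ioc (-(T / 2)) (-(T / 2) + T), n / weight n (a : AddCircle T)
      ≤ T⁻¹ * ∫ a, (n : ℝ) * (1 + (4 * n / T * a) ^ 2)⁻¹ := by
        gcongr
        refine (setIntegral_mono_on (hcont.integrableOn_Icc.mono_set Set.Ioc_subset_Icc_self)
          hint.integrableOn measurableSet_Ioc hpt).trans ?_
        exact setIntegral_le_integral hint (Filter.Eventually.of_forall fun a => by positivity)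
    _ = π / 4 := by
        rw [integral_const_mul, Measure.integral_comp_mul_left (fun y : ℝ => (1 + y ^ 2)⁻¹),
          integral_univ_inv_one_add_sq, smul_eq_mul, abs_of_pos (by positivity)]
        field_simp
    _ ≤ 1 := by linarith [Real.pi_lt_four]

namespace LipschitzSymbol

variable {n : ℕ} {M : ℝ} {a : ℤ → ℂ}

lemma integral_weight_mul_norm_sq_trigPoly_le (h : LipschitzSymbol n M a) :
    ∫ x : AddCircle T, weight n x * ‖trigPoly n a x‖ ^ 2 ∂AddCircle.haarAddCircle ≤
      2 * (2 * n + 1) * M ^ 2 := by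
  have expand (x : AddCircle T) : weight n x * ‖trigPoly n a x‖ ^ 2 =
      ‖trigPoly n a x‖ ^ 2 + n ^ 2 * ‖trigPoly n (fun k => a (k - 1) - a k) x‖ ^ 2 := by
    rw [← h.fourier_one_sub_one_mul_trigPoly, norm_mul, weight]
    ring
  simp_rw [expand]
  rw [integral_add (integrable_of_continuous (by fun_prop))
    (integrable_of_continuous (by fun_prop)), integral_const_mul]
  calc _ ≤ (2 * n + 1) * M ^ 2 + n ^ 2 * ((2 * n + 1) * (M / n) ^ 2) := by
        gcongr
        · exact integral_norm_sq_trigPoly_le h.norm_le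
        · exact integral_norm_sq_trigPoly_le fun k => by rw [norm_sub_rev]; exact h.norm_sub_le k
    _ = (2 * n + 1) * (M ^ 2 + (n * (M / n)) ^ 2) := by ring
    _ ≤ (2 * n + 1) * (M ^ 2 + M ^ 2) := by
        rcases n.eq_zero_or_pos with rfl | hn
        · simp [sq_nonneg]
        · rw [mul_div_cancel₀ _ (by positivity)]
    _ = 2 * (2 * n + 1) * M ^ 2 := by ring

lemma integral_norm_trigPoly_le (h : LipschitzSymbol n M a) :
    ∫ x : AddCircle T, ‖trigPoly n a x‖ ∂AddCircle.haarAddCircle ≤ 4 * M := by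
  rcases n.eq_zero_or_pos with rfl | hn
  · have h0 (k : ℤ) : a k = 0 := h.eq_zero_of_le k (by simp)
    simp [trigPoly, h0, h.nonneg]
  rcases h.nonneg.eq_or_lt with rfl | hM
  · have h0 (k : ℤ) : a k = 0 := norm_le_zero_iff.1 (h.norm_le k)
    simp [trigPoly, h0]
  have hn' : (1 : ℝ) ≤ n := by exact_mod_cast hn
  -- AM-GM for the two factors of `‖P‖ = √(n / w) * √(w ‖P‖² / n)`
  have am_gm (x : AddCircle T) : ‖trigPoly n a x‖ ≤
      M / 2 * (n / weight n x) + (2 * M * n)⁻¹ * (weight n x * ‖trigPoly n a x‖ ^ 2) := by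
    have hw := weight_pos n x
    have sq : M / 2 * (n / weight n x) + (2 * M * n)⁻¹ * (weight n x * ‖trigPoly n a x‖ ^ 2) -
        ‖trigPoly n a x‖ =
        (M * n - weight n x * ‖trigPoly n a x‖) ^ 2 / (2 * M * n * weight n x) := by
      field_simp
      ring
    rw [← sub_nonneg, sq]
    positivity
  have hcont : Continuous fun x : AddCircle T => n / weight n x :=
    continuous_const.div (continuous_weight n) fun x => (weight_pos n x).ne'
  calc ∫ x : AddCircle T, ‖trigPoly n a x‖ ∂AddCircle.haarAddCircle
      ≤ ∫ x : AddCircle T, (M / 2 * (n / weight n x) +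
          (2 * M * n)⁻¹ * (weight n x * ‖trigPoly n a x‖ ^ 2)) ∂AddCircle.haarAddCircle :=
        integral_mono (integrable_of_continuous (by fun_prop))
          (integrable_of_continuous (by fun_prop)) am_gm
    _ = M / 2 * ∫ x : AddCircle T, n / weight n x ∂AddCircle.haarAddCircle + (2 * M * n)⁻¹ *
          ∫ x : AddCircle T, weight n x * ‖trigPoly n a x‖ ^ 2 ∂AddCircle.haarAddCircle := by
        rw [integral_add (integrable_of_continuous (by fun_prop))
          (integrable_of_continuous (by fun_prop)), integral_const_mul, integral_const_mul]
    _ ≤ M / 2 * 1 + (2 * M * n)⁻¹ * (2 * (2 * n + 1) * M ^ 2) := by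
        gcongr
        exacts [integral_div_weight_le n, h.integral_weight_mul_norm_sq_trigPoly_le]
    _ = 5 / 2 * M + M / n := by
        field_simp
        ring
    _ ≤ 4 * M := by linarith [div_le_self hM.le hn']

theorem eLpNorm_one_trigPoly_le (h : LipschitzSymbol n M a) :
    eLpNorm (trigPoly (T := T) n a) 1 AddCircle.haarAddCircle ≤ ENNReal.ofReal (4 * M) := by
  rw [eLpNorm_one_eq_lintegral_enorm,
    ← ofReal_integral_norm_eq_lintegral_enorm (integrable_of_continuous (by fun_prop))]
  exact ENNReal.ofReal_le_ofReal h.integral_norm_trigPoly_le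

end LipschitzSymbol

end Circle

/-! ### Differences of functions on a group -/

section Translation

variable {G E : Type*} [AddCommGroup G] [MeasurableSpace G] [MeasurableAdd G]
  [NormedAddCommGroup E] {μ : Measure G} [μ.IsAddRightInvariant] {p : ℝ≥0∞} {f : G → E}

lemma aestronglyMeasurable_fwdDiff (hf : AEStronglyMeasurable f μ) (h : G) :
    AEStronglyMeasurable (fwdDiff h f) μ :=
  (hf.comp_measurePreserving (measurePreserving_add_right μ h)).sub hf

lemma memLp_fwdDiff (hf : MemLp f p μ) (h : G) : MemLp (fwdDiff h f) p μ :=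
  (hf.comp_measurePreserving (measurePreserving_add_right μ h)).sub hf

lemma eLpNorm_fwdDiff_le (hp : 1 ≤ p) (hf : AEStronglyMeasurable f μ) (h : G) :
    eLpNorm (fwdDiff h f) p μ ≤ 2 * eLpNorm f p μ := by
  have hmp := measurePreserving_add_right μ h
  calc eLpNorm (fwdDiff h f) p μ
      ≤ eLpNorm (f ∘ (· + h)) p μ + eLpNorm f p μ :=
        eLpNorm_sub_le (hf.comp_measurePreserving hmp) hf hp
    _ = 2 * eLpNorm f p μ := by rw [eLpNorm_comp_measurePreserving hf hmp, two_mul]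

lemma eLpNorm_iterate_fwdDiff_le (hp : 1 ≤ p) (hf : AEStronglyMeasurable f μ) (h : G) (l : ℕ) :
    eLpNorm ((fwdDiff h)^[l] f) p μ ≤ 2 ^ l * eLpNorm f p μ := by
  induction l generalizing f with
  | zero => simp
  | succ l ih =>
    rw [Function.iterate_succ_apply, pow_succ, mul_assoc]
    refine (ih (aestronglyMeasurable_fwdDiff hf h)).trans ?_
    gcongr
    exact eLpNorm_fwdDiff_le hp hf h

end Translation

/-! ### The de la Vallée Poussin kernels -/

/-- The Fourier coefficients of the kernels `𝒱_{2^{s-1}}`, with `𝒱_{1/2} = 1` for `s = 0`. -/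
def lowCoeff (s : ℕ) (k : ℤ) : ℂ := (max 0 (min 1 (2 - 2 * |(k : ℝ)| / 2 ^ s)) : ℝ)

lemma lowCoeff_eq_zero {s : ℕ} {k : ℤ} (h : (2 : ℤ) ^ s ≤ |k|) : lowCoeff s k = 0 := by
  have h' : (2 : ℝ) ^ s ≤ |(k : ℝ)| := by exact_mod_cast h
  rw [lowCoeff, max_eq_left, Complex.ofReal_zero]
  refine (min_le_right _ _).trans ?_
  rw [sub_nonpos, le_div_iff₀ (by positivity)]
  linarith

lemma lowCoeff_eq_one {s : ℕ} {k : ℤ} (h : 2 * |k| ≤ (2 : ℤ) ^ s) : lowCoeff s k = 1 := by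
  have h' : 2 * |(k : ℝ)| / 2 ^ s ≤ 1 := by
    rw [div_le_one (by positivity)]
    exact_mod_cast h
  rw [lowCoeff, min_eq_left (by linarith), max_eq_right zero_le_one, Complex.ofReal_one]

lemma norm_lowCoeff_le_one (s : ℕ) (k : ℤ) : ‖lowCoeff s k‖ ≤ 1 := by
  rw [lowCoeff, Complex.norm_real, Real.norm_of_nonneg (le_max_left _ _)]
  exact max_le zero_le_one (min_le_left _ _)

lemma norm_lowCoeff_sub_le (s : ℕ) (k : ℤ) :
    ‖lowCoeff s k - lowCoeff s (k - 1)‖ ≤ 2 / 2 ^ s := by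
  have clamp (x y : ℝ) : |max 0 (min 1 x) - max 0 (min 1 y)| ≤ |x - y| :=
    (abs_max_sub_max_le_max _ _ _ _).trans <| by
      simpa using abs_min_sub_min_le_max 1 x 1 y
  rw [lowCoeff, lowCoeff, ← Complex.ofReal_sub, Complex.norm_real, Real.norm_eq_abs]
  refine (clamp _ _).trans ?_
  calc |2 - 2 * |(k : ℝ)| / 2 ^ s - (2 - 2 * |((k - 1 : ℤ) : ℝ)| / 2 ^ s)|
      = abs (2 / 2 ^ s * (|((k - 1 : ℤ) : ℝ)| - |(k : ℝ)|)) := by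
        congr 1
        ring
    _ = 2 / 2 ^ s * abs (|((k - 1 : ℤ) : ℝ)| - |(k : ℝ)|) := by
        rw [abs_mul, abs_of_pos (by positivity)]
    _ ≤ 2 / 2 ^ s * |((k - 1 : ℤ) : ℝ) - k| := by
        gcongr ?_ * ?_
        exact abs_abs_sub_abs_le _ _
    _ = 2 / 2 ^ s := by push_cast; simp

lemma lipschitzSymbol_lowCoeff (s : ℕ) : LipschitzSymbol (2 ^ s) 2 (lowCoeff s) where
  eq_zero_of_le k hk := lowCoeff_eq_zero (by exact_mod_cast hk)
  norm_le k := (norm_lowCoeff_le_one s k).trans one_le_two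
  norm_sub_le k := by exact_mod_cast norm_lowCoeff_sub_le s k

/-- The kernels `𝒱_{2^{s-1}}`, with `𝒱_{1/2} = 1` for `s = 0`. -/
def lowKernel (s : ℕ) : AddCircle (2 * π) → ℂ := trigPoly (2 ^ s) (lowCoeff s)

@[fun_prop]
lemma continuous_lowKernel (s : ℕ) : Continuous (lowKernel s) := continuous_trigPoly _ _

lemma eLpNorm_one_lowKernel_le (s : ℕ) :
    eLpNorm (lowKernel s) 1 AddCircle.haarAddCircle ≤ 8 := by
  refine (lipschitzSymbol_lowCoeff s).eLpNorm_one_trigPoly_le.trans_eq ?_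
  norm_num

lemma lowKernel_zero : lowKernel 0 = 1 := by
  ext x
  rw [lowKernel, trigPoly, Finset.sum_eq_single 0]
  · simp [lowCoeff_eq_one]
  · intro k _ hk
    rw [lowCoeff_eq_zero (by simpa using Int.one_le_abs hk), zero_mul]
  · simp

lemma vallePoussinKernel_eq_trigPoly (n : ℕ) :
    vallePoussinKernel n =
      trigPoly (2 * n) fun k => (n : ℂ)⁻¹ *
        ((Finset.Ico n (2 * n)).filter fun l : ℕ => |k| ≤ l).card := by
  have dirichlet (l : ℕ) (hl : l ∈ Finset.Ico n (2 * n)) :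
      dirichletKernel l = trigPoly (2 * n) fun k => if |k| ≤ l then 1 else 0 := by
    rw [← trigPoly_eq_of_le (Finset.mem_Ico.1 hl).2.le fun k hk => if_neg (not_le.2 hk),
      trigPoly_congr fun k hk => if_pos hk]
    ext x
    simp [dirichletKernel, trigPoly]
  ext x
  rw [vallePoussinKernel, Finset.sum_congr rfl fun l hl => congrFun (dirichlet l hl) x]
  simp only [trigPoly]
  rw [Finset.sum_comm, Finset.mul_sum]
  refine Finset.sum_congr rfl fun k _ => ?_
  rw [← Finset.sum_mul, ← mul_assoc, Finset.sum_boole]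

lemma card_filter_Ico_abs_le (n : ℕ) (k : ℤ) :
    (((Finset.Ico n (2 * n)).filter fun l : ℕ => |k| ≤ l).card : ℝ) =
      max 0 (min (n : ℝ) (2 * n - |(k : ℝ)|)) := by
  have hcard : ((Finset.Ico n (2 * n)).filter fun l : ℕ => |k| ≤ l).card =
      2 * n - max n k.natAbs := by
    rw [← Nat.card_Ico]
    congr 1
    ext l
    simp only [Finset.mem_filter, Finset.mem_Ico, max_le_iff, Int.abs_eq_natAbs]
    lia
  have htoNat : ((2 * n - max n k.natAbs : ℕ) : ℤ) = max 0 (min (n : ℤ) (2 * n - |k|)) := by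
    rw [Int.abs_eq_natAbs]
    lia
  rw [hcard]
  exact_mod_cast congrArg (Int.cast (R := ℝ)) htoNat

lemma lowKernel_succ (s : ℕ) : lowKernel (s + 1) = vallePoussinKernel (2 ^ s) := by
  have hpos : (0 : ℝ) < 2 ^ s := by positivity
  rw [vallePoussinKernel_eq_trigPoly, lowKernel, pow_succ']
  congr 1
  ext k
  rw [lowCoeff, ← Complex.ofReal_natCast (Finset.card _), card_filter_Ico_abs_le,
    ← Complex.ofReal_natCast, ← Complex.ofReal_inv, ← Complex.ofReal_mul]
  congr 1
  push_cast
  rw [mul_max_of_nonneg _ _ (by positivity), mul_min_of_nonneg _ _ (by positivity), mul_zero,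
    inv_mul_cancel₀ hpos.ne', pow_succ]
  congr 2
  field_simp

lemma blockKernel_zero : blockKernel 0 = lowKernel 0 := by
  rw [lowKernel_zero]
  rfl

lemma blockKernel_succ (s : ℕ) : blockKernel (s + 1) = lowKernel (s + 1) - lowKernel s := by
  cases s with
  | zero => rw [lowKernel_succ, lowKernel_zero]; rfl
  | succ s => rw [lowKernel_succ, lowKernel_succ]; rfl

/-- The Fourier coefficients of `𝒜_s`. -/
def blockCoeff : ℕ → ℤ → ℂ
  | 0 => lowCoeff 0
  | s + 1 => lowCoeff (s + 1) - lowCoeff s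

lemma blockKernel_eq_trigPoly (s : ℕ) : blockKernel s = trigPoly (2 ^ s) (blockCoeff s) := by
  cases s with
  | zero => exact blockKernel_zero
  | succ s =>
    have hlow : lowKernel s = trigPoly (2 ^ (s + 1)) (lowCoeff s) :=
      trigPoly_eq_of_le (Nat.pow_le_pow_right two_pos s.le_succ) fun k hk =>
        lowCoeff_eq_zero (by exact_mod_cast hk.le)
    rw [blockKernel_succ, hlow, lowKernel, ← trigPoly_sub, blockCoeff]

@[fun_prop]
lemma continuous_blockKernel (s : ℕ) : Continuous (blockKernel s) := by
  rw [blockKernel_eq_trigPoly]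
  fun_prop

lemma blockCoeff_succ_eq_zero {s : ℕ} {k : ℤ} (h : 4 * |k| ≤ (2 : ℤ) ^ (s + 1)) :
    blockCoeff (s + 1) k = 0 := by
  rw [blockCoeff, Pi.sub_apply, lowCoeff_eq_one (by linarith [abs_nonneg k]),
    lowCoeff_eq_one (by rw [pow_succ] at h; linarith), sub_self]

lemma lipschitzSymbol_blockCoeff (s : ℕ) : LipschitzSymbol (2 ^ s) 6 (blockCoeff s) := by
  cases s with
  | zero => exact (lipschitzSymbol_lowCoeff 0).mono (by norm_num)
  | succ s =>
    have hlow : LipschitzSymbol (2 ^ (s + 1)) 4 (lowCoeff s) := by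
      have h := (lipschitzSymbol_lowCoeff s).two_mul
      norm_num at h
      rwa [pow_succ']
    have h := (lipschitzSymbol_lowCoeff (s + 1)).sub hlow
    norm_num at h
    exact h

lemma eLpNorm_one_blockKernel_le (s : ℕ) :
    eLpNorm (blockKernel s) 1 AddCircle.haarAddCircle ≤ 24 := by
  rw [blockKernel_eq_trigPoly]
  refine (lipschitzSymbol_blockCoeff s).eLpNorm_one_trigPoly_le.trans_eq ?_
  norm_num

lemma one_div_seven_le_norm_fourier_sub_one {s : ℕ} {k : ℤ} (hk : blockCoeff (s + 1) k ≠ 0) :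
    1 / 7 ≤ ‖fourier k ((((2 : ℝ) ^ (s + 1))⁻¹ : ℝ) : AddCircle (2 * π)) - 1‖ := by
  have hupper : |(k : ℝ)| ≤ 2 ^ (s + 1) := by
    have h := mt ((lipschitzSymbol_blockCoeff (s + 1)).eq_zero_of_le k) hk
    exact_mod_cast (not_le.1 h).le
  have hlower : (2 : ℝ) ^ (s + 1) ≤ 4 * |(k : ℝ)| := by
    exact_mod_cast (not_le.1 (mt blockCoeff_succ_eq_zero hk)).le
  have hle_one : |(k : ℝ) / 2 ^ (s + 1)| ≤ 1 := by
    rw [abs_div, abs_of_pos (show (0 : ℝ) < 2 ^ (s + 1) by positivity)]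
    exact div_le_one_of_le₀ hupper (by positivity)
  have hquarter_le : 1 / 4 ≤ |(k : ℝ) / 2 ^ (s + 1)| := by
    rw [abs_div, abs_of_pos (show (0 : ℝ) < 2 ^ (s + 1) by positivity), le_div_iff₀ (by positivity)]
    linarith
  have hπ : 4 / 7 ≤ 2 / π := by
    rw [div_le_div_iff₀ (by norm_num) Real.pi_pos]
    linarith [Real.pi_lt_d2]
  rw [fourier_coe_eq_exp, div_self Real.two_pi_pos.ne', one_mul, ← div_eq_mul_inv]
  calc 1 / 7 = 4 / 7 * (1 / 4 : ℝ) := by norm_num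
    _ ≤ 2 / π * |(k : ℝ) / 2 ^ (s + 1)| := by gcongr
    _ ≤ _ := two_div_pi_mul_abs_le_norm_exp_sub_one (hle_one.trans (by linarith [Real.pi_gt_three]))

theorem exists_iterate_fwdDiff_eq_blockKernel (l s : ℕ) :
    ∃ K : AddCircle (2 * π) → ℂ, Continuous K ∧
      eLpNorm K 1 AddCircle.haarAddCircle ≤ ENNReal.ofReal (24 * 56 ^ l) ∧
      (fwdDiff ((((2 : ℝ) ^ (s + 1))⁻¹ : ℝ) : AddCircle (2 * π)))^[l] K = blockKernel (s + 1) := by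
  set t : AddCircle (2 * π) := ((((2 : ℝ) ^ (s + 1))⁻¹ : ℝ) : AddCircle (2 * π))
  have hlower (k : ℤ) (hk : blockCoeff (s + 1) k ≠ 0) : 7⁻¹ ≤ ‖fourier k t - 1‖ := by
    rw [← one_div]
    exact one_div_seven_le_norm_fourier_sub_one hk
  have hne (k : ℤ) (hk : blockCoeff (s + 1) k ≠ 0) : fourier k t - 1 ≠ 0 :=
    norm_pos_iff.1 (lt_of_lt_of_le (by norm_num) (hlower k hk))
  have hinv (k : ℤ) (hk : blockCoeff (s + 1) k ≠ 0) : ‖(fourier k t - 1)⁻¹‖ ≤ 7 := by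
    rw [norm_inv]
    exact inv_le_of_inv_le₀ (by norm_num) (hlower k hk)
  have hinv_sub (k : ℤ) (hk : blockCoeff (s + 1) k ≠ 0) (hk' : blockCoeff (s + 1) (k - 1) ≠ 0) :
      ‖(fourier k t - 1)⁻¹ - (fourier (k - 1) t - 1)⁻¹‖ ≤ 49 / (2 ^ (s + 1) : ℕ) := by
    have hstep : ‖fourier 1 t - 1‖ ≤ ((2 : ℝ) ^ (s + 1))⁻¹ := by
      refine (norm_fourier_coe_sub_one_le 1 _).trans_eq ?_
      rw [div_self Real.two_pi_pos.ne', one_mul, Int.cast_one, one_mul, abs_of_pos (by positivity)]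
    rw [inv_sub_inv (hne k hk) (hne _ hk'), sub_sub_sub_cancel_right, div_eq_mul_inv, mul_inv,
      norm_mul, norm_mul, norm_sub_rev, norm_fourier_sub_fourier_pred]
    calc _ ≤ ((2 : ℝ) ^ (s + 1))⁻¹ * (7 * 7) := by
          gcongr
          exacts [hinv k hk, hinv _ hk']
      _ = _ := by push_cast; ring
  have hsymbol := (lipschitzSymbol_blockCoeff (s + 1)).pow_mul (by norm_num) (by norm_num)
    hinv hinv_sub l
  refine ⟨_, continuous_trigPoly _ _, hsymbol.eLpNorm_one_trigPoly_le.trans_eq ?_, ?_⟩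
  · congr 1
    ring
  · rw [iterate_fwdDiff_trigPoly, blockKernel_eq_trigPoly]
    congr 1
    ext k
    by_cases hk : blockCoeff (s + 1) k = 0
    · rw [hk, mul_zero, mul_zero]
    · rw [← mul_assoc, ← mul_pow, mul_inv_cancel₀ (hne k hk), one_pow, one_mul]

theorem eLpNorm_one_iterate_fwdDiff_lowKernel_le (l s : ℕ) (t : ℝ) :
    eLpNorm ((fwdDiff (t : AddCircle (2 * π)))^[l] (lowKernel s)) 1 AddCircle.haarAddCircle ≤
      ENNReal.ofReal (8 * 2 ^ l * min 1 (2 ^ s * |t|) ^ l) := by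
  rcases le_total 1 ((2 : ℝ) ^ s * |t|) with h | h
  · rw [min_eq_left h, one_pow, mul_one]
    calc _ ≤ 2 ^ l * eLpNorm (lowKernel s) 1 AddCircle.haarAddCircle :=
          eLpNorm_iterate_fwdDiff_le le_rfl (continuous_lowKernel s).aestronglyMeasurable _ _
      _ ≤ 2 ^ l * 8 := by gcongr; exact eLpNorm_one_lowKernel_le s
      _ = ENNReal.ofReal (8 * 2 ^ l) := by
          rw [mul_comm, ENNReal.ofReal_mul (by norm_num), ENNReal.ofReal_pow (by norm_num)]
          norm_num
  have hω : 2 * π / (2 * π) = 1 := div_self Real.two_pi_pos.ne'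
  have hbound (k : ℤ) (hk : lowCoeff s k ≠ 0) :
      ‖fourier k (t : AddCircle (2 * π)) - 1‖ ≤ 2 ^ s * |t| := by
    have hk' : |(k : ℝ)| ≤ 2 ^ s := by exact_mod_cast (not_le.1 (mt lowCoeff_eq_zero hk)).le
    refine (norm_fourier_coe_sub_one_le k t).trans ?_
    rw [hω, one_mul, abs_mul]
    gcongr
  have hstep (k : ℤ) : ‖(fourier k (t : AddCircle (2 * π)) - 1) -
      (fourier (k - 1) (t : AddCircle (2 * π)) - 1)‖ ≤
      2 ^ s * |t| / (2 ^ s : ℕ) := by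
    rw [sub_sub_sub_cancel_right, norm_fourier_sub_fourier_pred]
    refine (norm_fourier_coe_sub_one_le 1 t).trans_eq ?_
    rw [hω, one_mul, Int.cast_one, one_mul]
    push_cast
    field_simp
  have hsymbol := (lipschitzSymbol_lowCoeff s).pow_mul (by positivity) (by positivity) hbound
    (fun k _ _ => hstep k) l
  rw [lowKernel, iterate_fwdDiff_trigPoly, min_eq_right h]
  refine hsymbol.eLpNorm_one_trigPoly_le.trans_eq ?_
  rw [← two_mul, mul_pow]
  congr 1
  ring

lemma rpow_sub_one_mul_self {p : ℝ} (hp : 1 ≤ p) (x : ℝ≥0∞) : x ^ (p - 1) * x = x ^ p := by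
  nth_rewrite 2 [← ENNReal.rpow_one x]
  rw [← ENNReal.rpow_add_of_nonneg _ _ (by linarith) zero_le_one, sub_add_cancel]

lemma lintegral_rpow_le {α : Type*} [MeasurableSpace α] {μ : Measure α} {p : ℝ} (hp : 1 ≤ p)
    {f : α → ℝ≥0∞} (hf : AEMeasurable f μ) :
    (∫⁻ x, f x ∂μ) ^ p ≤ μ Set.univ ^ (p - 1) * ∫⁻ x, f x ^ p ∂μ := by
  have hp0 : 0 < p := by linarith
  have holder := eLpNorm'_le_eLpNorm'_mul_rpow_measure_univ one_pos hp hf.aestronglyMeasurable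
  simp only [eLpNorm', ENNReal.rpow_one, div_one, enorm_eq_self] at holder
  calc (∫⁻ x, f x ∂μ) ^ p
      ≤ ((∫⁻ x, f x ^ p ∂μ) ^ (1 / p) * μ Set.univ ^ (1 - 1 / p)) ^ p := by gcongr
    _ = μ Set.univ ^ (p - 1) * ∫⁻ x, f x ^ p ∂μ := by
        rw [ENNReal.mul_rpow_of_nonneg _ _ hp0.le, ← ENNReal.rpow_mul, ← ENNReal.rpow_mul,
          one_div_mul_cancel hp0.ne', ENNReal.rpow_one, sub_mul, one_div_mul_cancel hp0.ne',
          one_mul, mul_comm]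

lemma lintegral_mul_rpow_le {α : Type*} [MeasurableSpace α] {μ : Measure α} {p : ℝ} (hp : 1 ≤ p)
    {f g : α → ℝ≥0∞} (hf : AEMeasurable f μ) (hg : AEMeasurable g μ) :
    (∫⁻ x, f x * g x ∂μ) ^ p ≤ (∫⁻ x, g x ∂μ) ^ (p - 1) * ∫⁻ x, f x ^ p * g x ∂μ := by
  have h := lintegral_rpow_le hp (hf.mono_ac (withDensity_absolutelyContinuous μ g))
  rw [lintegral_withDensity_eq_lintegral_mul₀ hg hf,
    lintegral_withDensity_eq_lintegral_mul₀ hg (hf.pow_const p), withDensity_apply _ .univ,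
    setLIntegral_univ] at h
  simpa only [Pi.mul_apply, mul_comm] using h

lemma trigPoly_eq_integral_mul_lowKernel {n s : ℕ} (h : 2 * n ≤ 2 ^ s) (c : ℤ → ℂ)
    (x : AddCircle (2 * π)) :
    trigPoly n c x = ∫ y, trigPoly n c y * lowKernel s (x - y) ∂AddCircle.haarAddCircle := by
  let c' : ℤ → ℂ := fun k => if |k| ≤ n then c k else 0
  have hc' : trigPoly (T := 2 * π) n c = trigPoly (2 ^ s) c' := by
    rw [trigPoly_congr (b := c') fun k hk => (if_pos hk).symm]
    exact trigPoly_eq_of_le (by lia) fun k hk => if_neg (not_le.2 hk)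
  rw [hc', lowKernel, integral_trigPoly_mul_trigPoly]
  refine congrFun (trigPoly_congr fun k _ => ?_) x
  simp only [c']
  split_ifs with hk
  · rw [lowCoeff_eq_one, one_mul]
    have : ((2 * n : ℕ) : ℤ) ≤ (2 ^ s : ℕ) := Int.ofNat_le.2 h
    push_cast at this
    linarith
  · rw [mul_zero]

lemma enorm_lowKernel_succ_le (s : ℕ) (x : AddCircle (2 * π)) :
    ‖lowKernel (s + 1) x‖ₑ ≤ 8 * 2 ^ s := by
  calc ‖lowKernel (s + 1) x‖ₑ ≤ 2 * (2 ^ (s + 1) : ℕ) + 1 :=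
        enorm_trigPoly_le (norm_lowCoeff_le_one _) x
    _ ≤ 8 * 2 ^ s := by
        have h : 2 * 2 ^ (s + 1) + 1 ≤ 8 * 2 ^ s := by
          rw [pow_succ]
          linarith [Nat.one_le_two_pow (n := s)]
        exact_mod_cast h

/-- Nikol'skii's inequality in one variable. -/
theorem enorm_trigPoly_rpow_le {p : ℝ} (hp : 1 ≤ p) (s : ℕ) (c : ℤ → ℂ) (x : AddCircle (2 * π)) :
    ‖trigPoly (2 ^ s) c x‖ₑ ^ p ≤
      8 ^ p * 2 ^ s *
        ∫⁻ y : AddCircle (2 * π), ‖trigPoly (2 ^ s) c y‖ₑ ^ p ∂AddCircle.haarAddCircle := by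
  have hker : ∫⁻ y : AddCircle (2 * π), ‖lowKernel (s + 1) (x - y)‖ₑ
      ∂AddCircle.haarAddCircle ≤ 8 := by
    rw [lintegral_sub_left_eq_self (‖lowKernel (s + 1) ·‖ₑ) x, ← eLpNorm_one_eq_lintegral_enorm]
    exact eLpNorm_one_lowKernel_le _
  calc ‖trigPoly (2 ^ s) c x‖ₑ ^ p
      ≤ (∫⁻ y, ‖trigPoly (2 ^ s) c y‖ₑ * ‖lowKernel (s + 1) (x - y)‖ₑ
          ∂AddCircle.haarAddCircle) ^ p := by
        gcongr
        rw [trigPoly_eq_integral_mul_lowKernel (pow_succ' 2 s).ge]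
        simp_rw [← enorm_mul]
        exact enorm_integral_le_lintegral_enorm _
    _ ≤ (∫⁻ y, ‖lowKernel (s + 1) (x - y)‖ₑ ∂AddCircle.haarAddCircle) ^ (p - 1) *
          ∫⁻ y, ‖trigPoly (2 ^ s) c y‖ₑ ^ p * ‖lowKernel (s + 1) (x - y)‖ₑ
            ∂AddCircle.haarAddCircle :=
        lintegral_mul_rpow_le hp (by fun_prop) (by fun_prop)
    _ ≤ 8 ^ (p - 1) *
          ∫⁻ y, ‖trigPoly (2 ^ s) c y‖ₑ ^ p * (8 * 2 ^ s) ∂AddCircle.haarAddCircle := by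
        gcongr
        exact enorm_lowKernel_succ_le s _
    _ = 8 ^ p * 2 ^ s *
        ∫⁻ y : AddCircle (2 * π), ‖trigPoly (2 ^ s) c y‖ₑ ^ p ∂AddCircle.haarAddCircle := by
        rw [lintegral_mul_const _ (by fun_prop), ← rpow_sub_one_mul_self hp 8]
        ring

/-! ### Convolutions -/

section Young

variable {G : Type*} [AddCommGroup G] [MeasurableSpace G] [MeasurableAdd₂ G] [MeasurableNeg G]
  {μ : Measure G} [SFinite μ] [μ.IsAddLeftInvariant] [μ.IsNegInvariant]

lemma lintegral_rpow_lintegral_mul_sub_le {p : ℝ} (hp : 1 ≤ p) {f k : G → ℝ≥0∞}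
    (hf : AEMeasurable f μ) (hk : AEMeasurable k μ) (hk' : ∫⁻ y, k y ∂μ ≠ ∞) :
    ∫⁻ x, (∫⁻ y, f y * k (x - y) ∂μ) ^ p ∂μ ≤ (∫⁻ y, k y ∂μ) ^ p * ∫⁻ y, f y ^ p ∂μ := by
  have hk_sub_left (x : G) : AEMeasurable (fun y => k (x - y)) μ :=
    hk.comp_quasiMeasurePreserving (Measure.measurePreserving_sub_left μ x).quasiMeasurePreserving
  have hk_sub_right (y : G) : AEMeasurable (fun x => k (x - y)) μ :=
    hk.comp_quasiMeasurePreserving (measurePreserving_sub_right μ y).quasiMeasurePreserving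
  have hmeas : AEMeasurable (fun z : G × G => f z.2 ^ p * k (z.1 - z.2)) (μ.prod μ) :=
    (hf.comp_snd.pow_const p).mul <|
      hk.comp_quasiMeasurePreserving (quasiMeasurePreserving_sub_of_right_invariant μ μ)
  calc ∫⁻ x, (∫⁻ y, f y * k (x - y) ∂μ) ^ p ∂μ
      ≤ ∫⁻ x, (∫⁻ y, k y ∂μ) ^ (p - 1) * ∫⁻ y, f y ^ p * k (x - y) ∂μ ∂μ := by
        gcongr with x
        rw [← lintegral_sub_left_eq_self k x]
        exact lintegral_mul_rpow_le hp hf (hk_sub_left x)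
    _ = (∫⁻ y, k y ∂μ) ^ (p - 1) * ∫⁻ y, f y ^ p * ∫⁻ x, k (x - y) ∂μ ∂μ := by
        rw [lintegral_const_mul' _ _ (ENNReal.rpow_ne_top_of_nonneg (by linarith) hk'),
          lintegral_lintegral_swap hmeas]
        congr 2 with y
        exact lintegral_const_mul'' _ (hk_sub_right y)
    _ = (∫⁻ y, k y ∂μ) ^ p * ∫⁻ y, f y ^ p ∂μ := by
        simp_rw [lintegral_sub_right_eq_self k]
        rw [lintegral_mul_const' _ _ hk', ← rpow_sub_one_mul_self hp]
        ring

theorem eLpNorm_convolution_le {𝕜 E E' F : Type*} [NontriviallyNormedField 𝕜]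
    [NormedAddCommGroup E] [NormedSpace 𝕜 E] [NormedAddCommGroup E'] [NormedSpace 𝕜 E']
    [NormedAddCommGroup F] [NormedSpace 𝕜 F] [NormedSpace ℝ F] (L : E →L[𝕜] E' →L[𝕜] F)
    {p : ℝ≥0∞} (hp : 1 ≤ p) {f : G → E} {g : G → E'} (hf : AEStronglyMeasurable f μ)
    (hg : Integrable g μ) :
    eLpNorm (f ⋆[L, μ] g) p μ ≤ ‖L‖ₑ * eLpNorm g 1 μ * eLpNorm f p μ := by
  have pointwise (x : G) : ‖(f ⋆[L, μ] g) x‖ₑ ≤ ‖L‖ₑ * ∫⁻ y, ‖f y‖ₑ * ‖g (x - y)‖ₑ ∂μ := by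
    rw [← lintegral_const_mul' _ _ enorm_ne_top]
    refine (enorm_integral_le_lintegral_enorm _).trans (lintegral_mono fun y => ?_)
    rw [← mul_assoc]
    exact (ContinuousLinearMap.le_opENorm _ _).trans
      (mul_le_mul_left (ContinuousLinearMap.le_opENorm _ _) _)
  rw [eLpNorm_one_eq_lintegral_enorm]
  rcases eq_or_ne p ∞ with rfl | hp_top
  · refine eLpNormEssSup_le_of_ae_enorm_bound (.of_forall fun x => (pointwise x).trans ?_)
    rw [mul_assoc, ← lintegral_sub_left_eq_self (‖g ·‖ₑ) x]
    gcongr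
    have hg_sub : AEMeasurable (fun y => ‖g (x - y)‖ₑ) μ :=
      hg.1.enorm.comp_quasiMeasurePreserving
        (Measure.measurePreserving_sub_left μ x).quasiMeasurePreserving
    rw [mul_comm, ← lintegral_const_mul'' _ hg_sub]
    refine lintegral_mono_ae ?_
    filter_upwards [enorm_ae_le_eLpNormEssSup f μ] with y hy
    gcongr
    exact hy
  · have hp0 : p ≠ 0 := (one_pos.trans_le hp).ne'
    have hp1 : 1 ≤ p.toReal := by simpa using ENNReal.toReal_mono hp_top hp
    rw [eLpNorm_eq_lintegral_rpow_enorm_toReal hp0 hp_top,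
      eLpNorm_eq_lintegral_rpow_enorm_toReal hp0 hp_top, one_div,
      ENNReal.rpow_inv_le_iff (by linarith), ENNReal.mul_rpow_of_nonneg _ _ (by linarith),
      ENNReal.rpow_inv_rpow (by linarith)]
    calc ∫⁻ x, ‖(f ⋆[L, μ] g) x‖ₑ ^ p.toReal ∂μ
        ≤ ∫⁻ x, ‖L‖ₑ ^ p.toReal * (∫⁻ y, ‖f y‖ₑ * ‖g (x - y)‖ₑ ∂μ) ^ p.toReal ∂μ := by
          gcongr with x
          rw [← ENNReal.mul_rpow_of_nonneg _ _ (by linarith)]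
          gcongr
          exact pointwise x
      _ = ‖L‖ₑ ^ p.toReal * ∫⁻ x, (∫⁻ y, ‖f y‖ₑ * ‖g (x - y)‖ₑ ∂μ) ^ p.toReal ∂μ :=
          lintegral_const_mul' _ _ (ENNReal.rpow_ne_top_of_nonneg (by linarith) enorm_ne_top)
      _ ≤ ‖L‖ₑ ^ p.toReal * ((∫⁻ y, ‖g y‖ₑ ∂μ) ^ p.toReal * ∫⁻ y, ‖f y‖ₑ ^ p.toReal ∂μ) := by
          gcongr
          exact lintegral_rpow_lintegral_mul_sub_le hp1 hf.enorm hg.1.enorm hg.2.ne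
      _ = (‖L‖ₑ * ∫⁻ y, ‖g y‖ₑ ∂μ) ^ p.toReal * ∫⁻ y, ‖f y‖ₑ ^ p.toReal ∂μ := by
          rw [ENNReal.mul_rpow_of_nonneg _ _ (by linarith), mul_assoc]

end Young

section Torus

variable {d : ℕ}

instance : IsProbabilityMeasure (torusMeasure d) := by
  unfold torusMeasure; infer_instance

instance : (torusMeasure d).IsAddHaarMeasure := by
  unfold torusMeasure; infer_instance

instance : (torusMeasure d).IsNegInvariant :=
  Measure.IsAddHaarMeasure.isNegInvariant_of_innerRegular _

/-- The convolution `f ∗ G` on `𝕋^d`. -/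
def conv (f G : Torus d → ℂ) : Torus d → ℂ :=
  f ⋆[.mul ℂ ℂ, torusMeasure d] G

/-- The tensor product of functions on the circle. -/
def tensor (K : Fin d → AddCircle (2 * π) → ℂ) (x : Torus d) : ℂ :=
  ∏ j, K j (x j)

lemma block_eq_conv (s : Fin d → ℕ) (f : Torus d → ℂ) :
    block s f = conv f (tensor fun j => blockKernel (s j)) := rfl

@[fun_prop]
lemma continuous_tensor {K : Fin d → AddCircle (2 * π) → ℂ} (hK : ∀ j, Continuous (K j)) :
    Continuous (tensor K) :=
  continuous_finsetProd _ fun j _ => (hK j).comp (continuous_apply j)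

lemma eLpNorm_one_tensor {K : Fin d → AddCircle (2 * π) → ℂ} (hK : ∀ j, Continuous (K j)) :
    eLpNorm (tensor K) 1 (torusMeasure d) = ∏ j, eLpNorm (K j) 1 AddCircle.haarAddCircle := by
  rw [eLpNorm_one_eq_lintegral_enorm, ← ofReal_integral_norm_eq_lintegral_enorm
    (integrable_of_continuous (continuous_tensor hK))]
  simp_rw [tensor, norm_prod]
  rw [torusMeasure, integral_fintype_prod_eq_prod (fun j x => ‖K j x‖),
    ENNReal.ofReal_prod_of_nonneg fun j _ => by positivity]
  refine Finset.prod_congr rfl fun j _ => ?_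
  rw [eLpNorm_one_eq_lintegral_enorm]
  exact ofReal_integral_norm_eq_lintegral_enorm (integrable_of_continuous (hK j))

section Linearity

variable {f g F G : Torus d → ℂ}

lemma convolutionExists_of_continuous (hf : Integrable f (torusMeasure d)) (hG : Continuous G) :
    ConvolutionExists f G (.mul ℂ ℂ) (torusMeasure d) :=
  HasCompactSupport.convolutionExists_right _ (.of_compactSpace G) hf.locallyIntegrable hG

lemma continuous_conv (hf : Integrable f (torusMeasure d)) (hG : Continuous G) :
    Continuous (conv f G) :=
  HasCompactSupport.continuous_convolution_right _ (.of_compactSpace G) hf.locallyIntegrable hG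

lemma add_conv (hf : Integrable f (torusMeasure d)) (hg : Integrable g (torusMeasure d))
    (hG : Continuous G) : conv (f + g) G = conv f G + conv g G :=
  (convolutionExists_of_continuous hf hG).add_distrib (convolutionExists_of_continuous hg hG)

lemma conv_add (hf : Integrable f (torusMeasure d)) (hF : Continuous F) (hG : Continuous G) :
    conv f (F + G) = conv f F + conv f G :=
  (convolutionExists_of_continuous hf hF).distrib_add (convolutionExists_of_continuous hf hG)

lemma smul_conv (c : ℂ) : conv (c • f) G = c • conv f G := smul_convolution

lemma conv_smul (c : ℂ) : conv f (c • G) = c • conv f G := convolution_smul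

lemma zero_conv : conv 0 G = 0 := zero_convolution

lemma conv_zero : conv f 0 = 0 := convolution_zero

lemma sub_conv (hf : Integrable f (torusMeasure d)) (hg : Integrable g (torusMeasure d))
    (hG : Continuous G) : conv (f - g) G = conv f G - conv g G := by
  rw [eq_sub_iff_add_eq, ← add_conv (hf.sub hg) hg hG, sub_add_cancel]

lemma conv_sub (hf : Integrable f (torusMeasure d)) (hF : Continuous F) (hG : Continuous G) :
    conv f (F - G) = conv f F - conv f G := by
  rw [eq_sub_iff_add_eq, ← conv_add hf (hF.sub hG) hG, sub_add_cancel]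

lemma conv_sum {ι : Type*} (S : Finset ι) (hf : Integrable f (torusMeasure d))
    {F : ι → Torus d → ℂ} (hF : ∀ i ∈ S, Continuous (F i)) :
    conv f (∑ i ∈ S, F i) = ∑ i ∈ S, conv f (F i) := by
  induction S using Finset.cons_induction with
  | empty => exact conv_zero
  | cons i S hi ih =>
    rw [Finset.forall_mem_cons] at hF
    rw [Finset.sum_cons, Finset.sum_cons, ← ih hF.2,
      conv_add hf hF.1 (by simpa only [Finset.sum_fn] using continuous_finsetSum S hF.2)]

lemma sum_conv {ι : Type*} (S : Finset ι) {f : ι → Torus d → ℂ}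
    (hf : ∀ i ∈ S, Integrable (f i) (torusMeasure d)) (hG : Continuous G) :
    conv (∑ i ∈ S, f i) G = ∑ i ∈ S, conv (f i) G := by
  induction S using Finset.cons_induction with
  | empty => exact zero_conv
  | cons i S hi ih =>
    rw [Finset.forall_mem_cons] at hf
    rw [Finset.sum_cons, Finset.sum_cons, ← ih hf.2,
      add_conv hf.1 (integrable_finsetSum' S hf.2) hG]

end Linearity

theorem eLpNorm_conv_tensor_le {p : ℝ≥0∞} (hp : 1 ≤ p) {f : Torus d → ℂ}
    (hf : AEStronglyMeasurable f (torusMeasure d)) {K : Fin d → AddCircle (2 * π) → ℂ}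
    (hK : ∀ j, Continuous (K j)) :
    eLpNorm (conv f (tensor K)) p (torusMeasure d) ≤
      (∏ j, eLpNorm (K j) 1 AddCircle.haarAddCircle) * eLpNorm f p (torusMeasure d) := by
  have h := eLpNorm_convolution_le (.mul ℂ ℂ) hp hf
    (integrable_of_continuous (continuous_tensor hK) : Integrable _ (torusMeasure d))
  have hmul : ‖ContinuousLinearMap.mul ℂ ℂ‖ₑ = 1 := by
    simp [enorm_eq_nnnorm]
  rwa [hmul, one_mul, eLpNorm_one_tensor hK] at h

/-! ### Mixed differences of convolutions -/

lemma fwdDiff_conv {f G : Torus d → ℂ} (hf : Integrable f (torusMeasure d)) (hG : Continuous G)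
    (h : Torus d) : conv (fwdDiff h f) G = fwdDiff h (conv f G) := by
  have translate : conv (fun y => f (y + h)) G = fun x => conv f G (x + h) := by
    ext x
    simp only [conv, convolution_def]
    rw [← integral_add_right_eq_self
      (fun y => ContinuousLinearMap.mul ℂ ℂ (f y) (G (x + h - y))) h]
    simp only [add_sub_add_right_eq_sub]
  change conv ((fun y => f (y + h)) - f) G = _
  rw [sub_conv (hf.comp_add_right h) hf hG, translate]
  rfl

lemma conv_fwdDiff {f G : Torus d → ℂ} (hf : Integrable f (torusMeasure d)) (hG : Continuous G)
    (h : Torus d) : conv f (fwdDiff h G) = fwdDiff h (conv f G) := by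
  have translate : conv f (fun y => G (y + h)) = fun x => conv f G (x + h) := by
    ext x
    simp only [conv, convolution_def, add_sub_right_comm]
  change conv f ((fun y => G (y + h)) - G) = _
  rw [conv_sub hf (by fun_prop) hG, translate]
  rfl

lemma mixedDiff_rel {R : (Torus d → ℂ) → (Torus d → ℂ) → Prop}
    (hR : ∀ f g h, R f g → R (fwdDiff h f) (fwdDiff h g)) {f g : Torus d → ℂ} (hfg : R f g)
    (l : ℕ) (t : Fin d → ℝ) (e : Finset (Fin d)) :
    R (mixedDiff l t e f) (mixedDiff l t e g) := by
  have partialDiff_rel (j : Fin d) {f g : Torus d → ℂ} (hfg : R f g) :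
      R (partialDiff l (t j) j f) (partialDiff l (t j) j g) := by
    unfold partialDiff
    induction l with
    | zero => exact hfg
    | succ l ih =>
      simp only [Function.iterate_succ_apply']
      exact hR _ _ _ ih
  unfold mixedDiff
  induction (List.finRange d).filter (· ∈ e) generalizing f g with
  | nil => exact hfg
  | cons j _ ih => exact ih (partialDiff_rel j hfg)

lemma memLp_mixedDiff {p : ℝ≥0∞} {f : Torus d → ℂ} (hf : MemLp f p (torusMeasure d)) (l : ℕ)
    (t : Fin d → ℝ) (e : Finset (Fin d)) : MemLp (mixedDiff l t e f) p (torusMeasure d) :=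
  mixedDiff_rel (R := fun f _ => MemLp f p (torusMeasure d)) (fun _ _ h hf => memLp_fwdDiff hf h)
    (g := f) hf l t e

lemma mixedDiff_conv {f G : Torus d → ℂ} (hf : Integrable f (torusMeasure d)) (hG : Continuous G)
    (l : ℕ) (t : Fin d → ℝ) (e : Finset (Fin d)) :
    conv (mixedDiff l t e f) G = mixedDiff l t e (conv f G) :=
  (mixedDiff_rel (R := fun f g => MemLp f 1 (torusMeasure d) ∧ conv f G = g)
    (fun f g h ⟨hf, hfg⟩ => ⟨memLp_fwdDiff hf h, by
      rw [fwdDiff_conv (memLp_one_iff_integrable.1 hf) hG, hfg]⟩)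
    ⟨memLp_one_iff_integrable.2 hf, rfl⟩ l t e).2

lemma conv_mixedDiff {f G : Torus d → ℂ} (hf : Integrable f (torusMeasure d)) (hG : Continuous G)
    (l : ℕ) (t : Fin d → ℝ) (e : Finset (Fin d)) :
    conv f (mixedDiff l t e G) = mixedDiff l t e (conv f G) :=
  (mixedDiff_rel (R := fun G g => Continuous G ∧ conv f G = g)
    (fun G g h ⟨hG, hGg⟩ => ⟨by unfold fwdDiff; fun_prop, by rw [conv_fwdDiff hf hG, hGg]⟩)
    ⟨hG, rfl⟩ l t e).2

lemma fwdDiff_tensor (K : Fin d → AddCircle (2 * π) → ℂ) (j : Fin d) (t : AddCircle (2 * π)) :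
    fwdDiff (Pi.single j t) (tensor K) = tensor (Function.update K j (fwdDiff t (K j))) := by
  ext x
  have hupdate (k : AddCircle (2 * π) → ℂ) :
      tensor (Function.update K j k) x = k (x j) * ∏ i ∈ Finset.univ.erase j, K i (x i) := by
    rw [tensor, ← Finset.mul_prod_erase _ _ (Finset.mem_univ j), Function.update_self]
    congr 1
    exact Finset.prod_congr rfl fun i hi => by
      rw [Function.update_of_ne (Finset.ne_of_mem_erase hi)]
  have htranslate : tensor K (x + Pi.single j t) =
      K j (x j + t) * ∏ i ∈ Finset.univ.erase j, K i (x i) := by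
    rw [tensor, ← Finset.mul_prod_erase _ _ (Finset.mem_univ j), Pi.add_apply,
      Pi.single_eq_same]
    congr 1
    exact Finset.prod_congr rfl fun i hi => by
      rw [Pi.add_apply, Pi.single_eq_of_ne (Finset.ne_of_mem_erase hi), add_zero]
  have hself := hupdate (K j)
  rw [Function.update_eq_self] at hself
  rw [fwdDiff, htranslate, hself, hupdate, ← sub_mul, fwdDiff]

lemma partialDiff_tensor (K : Fin d → AddCircle (2 * π) → ℂ) (l : ℕ) (t : ℝ) (j : Fin d) :
    partialDiff l t j (tensor K) =
      tensor (Function.update K j ((fwdDiff (t : AddCircle (2 * π)))^[l] (K j))) := by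
  unfold partialDiff
  induction l with
  | zero => simp only [Function.iterate_zero, id_eq, Function.update_eq_self]
  | succ l ih =>
    rw [Function.iterate_succ_apply', Function.iterate_succ_apply', ih, fwdDiff_tensor,
      Function.update_idem, Function.update_self]

/-- The factors of `Δ_𝐭^l(e)` applied to a tensor product with factors `K`. -/
def diffFactor (l : ℕ) (t : Fin d → ℝ) (e : Finset (Fin d)) (K : Fin d → AddCircle (2 * π) → ℂ)
    (j : Fin d) : AddCircle (2 * π) → ℂ :=
  if j ∈ e then (fwdDiff (t j : AddCircle (2 * π)))^[l] (K j) else K j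

lemma continuous_diffFactor (l : ℕ) (t : Fin d → ℝ) (e : Finset (Fin d))
    {K : Fin d → AddCircle (2 * π) → ℂ} (hK : ∀ j, Continuous (K j)) (j : Fin d) :
    Continuous (diffFactor l t e K j) := by
  unfold diffFactor
  split_ifs
  · exact Function.Iterate.rec Continuous (hK j) (fun f hf => by unfold fwdDiff; fun_prop) l
  · exact hK j

lemma mixedDiff_tensor (l : ℕ) (t : Fin d → ℝ) (e : Finset (Fin d))
    (K : Fin d → AddCircle (2 * π) → ℂ) :
    mixedDiff l t e (tensor K) = tensor (diffFactor l t e K) := by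
  suffices ∀ (L : List (Fin d)), L.Nodup → ∀ K : Fin d → AddCircle (2 * π) → ℂ,
      L.foldl (fun g j => partialDiff l (t j) j g) (tensor K) =
        tensor (diffFactor l t L.toFinset K) by
    have he : ((List.finRange d).filter (· ∈ e)).toFinset = e := by ext j; simp
    rw [mixedDiff, this _ ((List.nodup_finRange d).filter _), he]
  intro L hL K
  induction L generalizing K with
  | nil => rfl
  | cons j L ih =>
    rw [List.nodup_cons] at hL
    rw [List.foldl_cons, partialDiff_tensor, ih hL.2]
    congr 1
    ext1 i
    rcases eq_or_ne i j with rfl | hij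
    · simp [diffFactor, hL.1]
    · simp [diffFactor, hij]

end Torus

section Torus

variable {d : ℕ}

/-! ### Trigonometric polynomials on the torus -/

/-- The character `e^{i⟨m, x⟩}` of the torus. -/
def chi (m : Fin d → ℤ) : Torus d → ℂ := tensor fun j => fourier (m j)

@[fun_prop]
lemma continuous_chi (m : Fin d → ℤ) : Continuous (chi m) :=
  continuous_tensor fun j => (fourier (m j)).continuous

lemma chi_zero : chi (0 : Fin d → ℤ) = 1 := by
  ext x
  simp [chi, tensor]

lemma chi_add (m n : Fin d → ℤ) : chi (m + n) = chi m * chi n := by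
  ext x
  simp only [chi, tensor, Pi.mul_apply, Pi.add_apply, fourier_add, Finset.prod_mul_distrib]

lemma star_chi (m : Fin d → ℤ) : star (chi m) = chi (-m) := by
  ext x
  simp only [chi, tensor, Pi.star_apply, Pi.neg_apply, fourier_neg, ← map_prod]
  rfl

lemma chi_sub_apply (m : Fin d → ℤ) (x y : Torus d) : chi m (x - y) = chi m x * chi (-m) y := by
  simp only [chi, tensor, Pi.sub_apply, Pi.neg_apply, fourier_apply_sub, Finset.prod_mul_distrib]

lemma chi_single (i : Fin d) (x : Torus d) : chi (Pi.single i 1) x = fourier 1 (x i) := by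
  rw [chi, tensor, Finset.prod_eq_single i (fun j _ hj => by simp [Pi.single_eq_of_ne hj])
    (by simp), Pi.single_eq_same]

/-- The trigonometric polynomials of degree at most `N_j` in the variable `x_j`. -/
def trigSpace (N : Fin d → ℕ) : Submodule ℂ (Torus d → ℂ) :=
  Submodule.span ℂ (chi '' {m | ∀ j, |m j| ≤ (N j : ℤ)})

section trigSpace

variable {N M : Fin d → ℕ} {F G : Torus d → ℂ}

lemma chi_mem_trigSpace {m : Fin d → ℤ} (h : ∀ j, |m j| ≤ (N j : ℤ)) : chi m ∈ trigSpace N :=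
  Submodule.subset_span ⟨m, h, rfl⟩

lemma trigSpace_mono (h : N ≤ M) : trigSpace N ≤ trigSpace M :=
  Submodule.span_mono (Set.image_mono fun _ hm j => (hm j).trans (by exact_mod_cast h j))

lemma continuous_of_mem_trigSpace (hF : F ∈ trigSpace N) : Continuous F := by
  induction hF using Submodule.span_induction with
  | mem F h => obtain ⟨m, _, rfl⟩ := h; exact continuous_chi m
  | zero => exact continuous_const
  | add F G _ _ hF hG => exact hF.add hG
  | smul c F _ hF => exact hF.const_smul c

lemma mul_mem_trigSpace (hF : F ∈ trigSpace N) (hG : G ∈ trigSpace M) :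
    F * G ∈ trigSpace (N + M) := by
  have hle : trigSpace N * trigSpace M ≤ trigSpace (N + M) := by
    rw [trigSpace, trigSpace, Submodule.span_mul_span, Submodule.span_le]
    rintro _ ⟨_, ⟨m, hm, rfl⟩, _, ⟨n, hn, rfl⟩, rfl⟩
    change chi m * chi n ∈ _
    rw [← chi_add]
    refine chi_mem_trigSpace fun j => (abs_add_le _ _).trans ?_
    rw [Pi.add_apply, Nat.cast_add]
    exact add_le_add (hm j) (hn j)
  exact hle (Submodule.mul_mem_mul hF hG)

lemma star_mem_trigSpace (hF : F ∈ trigSpace N) : star F ∈ trigSpace N := by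
  induction hF using Submodule.span_induction with
  | mem F h =>
    obtain ⟨m, hm, rfl⟩ := h
    rw [star_chi]
    exact chi_mem_trigSpace fun j => by rw [Pi.neg_apply, abs_neg]; exact hm j
  | zero => rw [star_zero]; exact zero_mem _
  | add F G _ _ hF hG => rw [star_add]; exact add_mem hF hG
  | smul c F _ hF => rw [star_smul]; exact Submodule.smul_mem _ _ hF

lemma exists_trigPoly_eq_update (hF : F ∈ trigSpace N) (j : Fin d) (x : Torus d) :
    ∃ c : ℤ → ℂ, ∀ y, F (Function.update x j y) = trigPoly (N j) c y := by
  induction hF using Submodule.span_induction with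
  | mem F h =>
    obtain ⟨m, hm, rfl⟩ := h
    refine ⟨fun k => if k = m j then ∏ i ∈ Finset.univ.erase j, fourier (m i) (x i) else 0,
      fun y => ?_⟩
    have hmem : m j ∈ Finset.Icc (-(N j : ℤ)) (N j : ℤ) := Finset.mem_Icc.2 (abs_le.1 (hm j))
    rw [trigPoly, Finset.sum_eq_single_of_mem _ hmem fun k _ hk => by rw [if_neg hk, zero_mul],
      if_pos rfl, chi, tensor, ← Finset.prod_erase_mul _ _ (Finset.mem_univ j),
      Function.update_self]
    congr 1
    exact Finset.prod_congr rfl fun i hi => by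
      rw [Function.update_of_ne (Finset.ne_of_mem_erase hi)]
  | zero => exact ⟨0, fun y => by simp [trigPoly]⟩
  | add F G _ _ hF hG =>
    obtain ⟨a, ha⟩ := hF
    obtain ⟨b, hb⟩ := hG
    exact ⟨a + b, fun y => by simp [ha, hb, trigPoly, add_mul, Finset.sum_add_distrib]⟩
  | smul c F _ hF =>
    obtain ⟨a, ha⟩ := hF
    exact ⟨c • a, fun y => by simp [ha, trigPoly, Finset.mul_sum, mul_assoc]⟩

lemma tensor_trigPoly_mem_trigSpace (N : Fin d → ℕ) (a : Fin d → ℤ → ℂ) :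
    tensor (fun j => trigPoly (N j) (a j)) ∈ trigSpace N := by
  have expand : tensor (fun j => trigPoly (N j) (a j)) =
      ∑ m ∈ Fintype.piFinset fun j => Finset.Icc (-(N j : ℤ)) (N j : ℤ),
        (∏ j, a j (m j)) • chi m := by
    ext x
    simp only [tensor, trigPoly, Finset.prod_univ_sum, Finset.sum_apply, Pi.smul_apply, chi,
      smul_eq_mul, Finset.prod_mul_distrib]
  rw [expand]
  refine Submodule.sum_mem _ fun m hm => Submodule.smul_mem _ _ (chi_mem_trigSpace fun j => ?_)
  exact abs_le.2 (Finset.mem_Icc.1 (Fintype.mem_piFinset.1 hm j))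

end trigSpace

/-- The algebra of all trigonometric polynomials, as continuous functions. -/
def trigAlgebra (d : ℕ) : StarSubalgebra ℂ C(Torus d, ℂ) where
  carrier := {F | ∃ N : Fin d → ℕ, ⇑F ∈ trigSpace N}
  mul_mem' := fun ⟨N, hN⟩ ⟨M, hM⟩ => ⟨N + M, mul_mem_trigSpace hN hM⟩
  add_mem' := fun ⟨N, hN⟩ ⟨M, hM⟩ =>
    ⟨N + M, add_mem (trigSpace_mono le_self_add hN) (trigSpace_mono le_add_self hM)⟩
  algebraMap_mem' := fun c => ⟨0, by
    have h : ⇑(algebraMap ℂ C(Torus d, ℂ) c) = c • chi 0 := by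
      ext x
      simp [chi_zero]
    rw [h]
    exact Submodule.smul_mem _ c (chi_mem_trigSpace fun j => by simp)⟩
  star_mem' := fun ⟨N, hN⟩ => ⟨N, star_mem_trigSpace hN⟩

lemma trigAlgebra_separatesPoints : (trigAlgebra d).SeparatesPoints := by
  intro x y hxy
  obtain ⟨i, hi⟩ := Function.ne_iff.1 hxy
  refine ⟨_, ⟨⟨chi (Pi.single i 1), continuous_chi _⟩,
    ⟨fun j => ((Pi.single i 1 : Fin d → ℤ) j).natAbs, chi_mem_trigSpace fun j => by simp⟩, rfl⟩,
    ?_⟩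
  change chi (Pi.single i 1) x ≠ chi (Pi.single i 1) y
  rw [chi_single, chi_single, fourier_one, fourier_one]
  exact fun h => hi (AddCircle.injective_toCircle Real.two_pi_pos.ne' (Subtype.ext h))

lemma exists_mem_trigSpace_norm_sub_lt {g : Torus d → ℂ} (hg : Continuous g) {ε : ℝ}
    (hε : 0 < ε) : ∃ (N : Fin d → ℕ) (F : Torus d → ℂ), F ∈ trigSpace N ∧ ∀ x, ‖g x - F x‖ < ε := by
  have hmem : (⟨g, hg⟩ : C(Torus d, ℂ)) ∈ (trigAlgebra d).topologicalClosure := by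
    rw [ContinuousMap.starSubalgebra_topologicalClosure_eq_top_of_separatesPoints _
      trigAlgebra_separatesPoints]
    trivial
  obtain ⟨F, ⟨N, hN⟩, hF⟩ := Metric.mem_closure_iff.1 hmem ε hε
  refine ⟨N, F, hN, fun x => ?_⟩
  rw [← dist_eq_norm]
  exact (ContinuousMap.dist_apply_le_dist x).trans_lt hF

theorem exists_mem_trigSpace_eLpNorm_sub_le {p : ℝ≥0∞} (hp1 : 1 ≤ p) (hp : p ≠ ∞)
    {f : Torus d → ℂ} (hf : MemLp f p (torusMeasure d)) {ε : ℝ≥0∞} (hε : ε ≠ 0) :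
    ∃ (N : Fin d → ℕ) (F : Torus d → ℂ), F ∈ trigSpace N ∧
      eLpNorm (f - F) p (torusMeasure d) ≤ ε := by
  wlog hε_top : ε ≠ ∞ generalizing ε
  · obtain ⟨N, F, hF, _⟩ := this one_ne_zero ENNReal.one_ne_top
    exact ⟨N, F, hF, by simp [not_not.1 hε_top]⟩
  have hε2 : ε / 2 ≠ 0 := (ENNReal.half_pos hε).ne'
  have hε2_top : ε / 2 ≠ ∞ := by finiteness
  obtain ⟨g, hfg, hg⟩ := hf.exists_boundedContinuous_eLpNorm_sub_le hp hε2
  obtain ⟨N, F, hF, hgF⟩ :=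
    exists_mem_trigSpace_norm_sub_lt g.continuous (ENNReal.toReal_pos hε2 hε2_top)
  have hFm := (continuous_of_mem_trigSpace hF).aestronglyMeasurable (μ := torusMeasure d)
  have hgF' : eLpNorm (⇑g - F) p (torusMeasure d) ≤ ε / 2 := by
    refine (eLpNorm_le_of_ae_bound (.of_forall fun x => (hgF x).le)).trans_eq ?_
    rw [measure_univ, ENNReal.one_rpow, one_mul, ENNReal.ofReal_toReal hε2_top]
  refine ⟨N, F, hF, ?_⟩
  calc eLpNorm (f - F) p (torusMeasure d)
      = eLpNorm ((f - ⇑g) + (⇑g - F)) p (torusMeasure d) := by rw [sub_add_sub_cancel]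
    _ ≤ eLpNorm (f - ⇑g) p (torusMeasure d) + eLpNorm (⇑g - F) p (torusMeasure d) :=
        eLpNorm_add_le (hf.1.sub hg.1) (hg.1.sub hFm) hp1
    _ ≤ ε / 2 + ε / 2 := add_le_add hfg hgF'
    _ = ε := ENNReal.add_halves ε

/-! ### Convolution with trigonometric polynomials -/

lemma conv_chi (f : Torus d → ℂ) (m : Fin d → ℤ) :
    conv f (chi m) = (∫ y, f y * chi (-m) y ∂torusMeasure d) • chi m := by
  ext x
  rw [Pi.smul_apply, smul_eq_mul, ← integral_mul_const]
  refine integral_congr_ae (.of_forall fun y => ?_)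
  simp only [ContinuousLinearMap.mul_apply', chi_sub_apply]
  ring

lemma conv_mem_trigSpace {f G : Torus d → ℂ} (hf : Integrable f (torusMeasure d))
    {N : Fin d → ℕ} (hG : G ∈ trigSpace N) : conv f G ∈ trigSpace N := by
  induction hG using Submodule.span_induction with
  | mem G h =>
    obtain ⟨m, hm, rfl⟩ := h
    rw [conv_chi]
    exact Submodule.smul_mem _ _ (chi_mem_trigSpace hm)
  | zero => rw [conv_zero]; exact zero_mem _
  | add F G hF hG ihF ihG =>
    rw [conv_add hf (continuous_of_mem_trigSpace hF) (continuous_of_mem_trigSpace hG)]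
    exact add_mem ihF ihG
  | smul c F _ ih => rw [conv_smul]; exact Submodule.smul_mem _ c ih

lemma block_mem_trigSpace (s : Fin d → ℕ) {f : Torus d → ℂ}
    (hf : Integrable f (torusMeasure d)) : block s f ∈ trigSpace fun j => 2 ^ s j := by
  rw [block_eq_conv]
  simp_rw [blockKernel_eq_trigPoly]
  exact conv_mem_trigSpace hf (tensor_trigPoly_mem_trigSpace _ _)

lemma chi_conv_tensor_trigPoly {n : Fin d → ℕ} {a : Fin d → ℤ → ℂ} {m : Fin d → ℤ}
    (h : ∀ j, a j (m j) ≠ 0 → |m j| ≤ n j) :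
    conv (chi m) (tensor fun j => trigPoly (n j) (a j)) = (∏ j, a j (m j)) • chi m := by
  ext x
  calc conv (chi m) (tensor fun j => trigPoly (n j) (a j)) x
      = ∫ y : Torus d, ∏ j, fourier (m j) (y j) * trigPoly (n j) (a j) (x j - y j)
          ∂torusMeasure d := by
        simp_rw [Finset.prod_mul_distrib]
        rfl
    _ = ∏ j, ∫ y, fourier (m j) y * trigPoly (n j) (a j) (x j - y) ∂AddCircle.haarAddCircle :=
        integral_fintype_prod_eq_prod fun j y => fourier (m j) y * trigPoly (n j) (a j) (x j - y)
    _ = ∏ j, a j (m j) * fourier (m j) (x j) :=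
        Finset.prod_congr rfl fun j _ => integral_fourier_mul_trigPoly (h j) _
    _ = ((∏ j, a j (m j)) • chi m) x := Finset.prod_mul_distrib

lemma conv_tensor_trigPoly_eq_smul {n N : Fin d → ℕ} {a : Fin d → ℤ → ℂ}
    (ha : ∀ j k, a j k ≠ 0 → |k| ≤ n j) {c : ℂ}
    (hc : ∀ m : Fin d → ℤ, (∀ j, |m j| ≤ N j) → ∏ j, a j (m j) = c)
    {F : Torus d → ℂ} (hF : F ∈ trigSpace N) :
    conv F (tensor fun j => trigPoly (n j) (a j)) = c • F := by
  induction hF using Submodule.span_induction with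
  | mem F hm =>
    obtain ⟨m, hm, rfl⟩ := hm
    rw [chi_conv_tensor_trigPoly fun j => ha j _, hc m hm]
  | zero => rw [zero_conv, smul_zero]
  | add F G hF hG ihF ihG =>
    rw [add_conv (integrable_of_continuous (continuous_of_mem_trigSpace hF))
      (integrable_of_continuous (continuous_of_mem_trigSpace hG)) (by fun_prop), ihF, ihG, smul_add]
  | smul a F hF ihF => rw [smul_conv, ihF, smul_comm]

lemma conv_lowKernel_eq_self {N s : Fin d → ℕ} (h : ∀ j, 2 * N j ≤ 2 ^ s j) {F : Torus d → ℂ}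
    (hF : F ∈ trigSpace N) : conv F (tensor fun j => lowKernel (s j)) = F := by
  have hcoeff (m : Fin d → ℤ) (hm : ∀ j, |m j| ≤ N j) : ∏ j, lowCoeff (s j) (m j) = 1 :=
    Finset.prod_eq_one fun j _ => lowCoeff_eq_one <| by
      have : 2 * (N j : ℤ) ≤ 2 ^ s j := by exact_mod_cast h j
      linarith [hm j]
  exact (conv_tensor_trigPoly_eq_smul
    (fun j _ => (lipschitzSymbol_lowCoeff (s j)).abs_le_of_ne_zero) hcoeff hF).trans (one_smul ℂ F)

lemma block_eq_zero_of_mem_trigSpace {N u : Fin d → ℕ} (j : Fin d) (hu : 1 ≤ u j)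
    (h : 4 * N j ≤ 2 ^ u j) {F : Torus d → ℂ} (hF : F ∈ trigSpace N) : block u F = 0 := by
  have hcoeff (m : Fin d → ℤ) (hm : ∀ j, |m j| ≤ N j) : ∏ j, blockCoeff (u j) (m j) = 0 := by
    refine Finset.prod_eq_zero (Finset.mem_univ j) ?_
    obtain ⟨v, hv⟩ := Nat.exists_eq_add_of_le' hu
    have : 4 * (N j : ℤ) ≤ 2 ^ (v + 1) := by rw [← hv]; exact_mod_cast h
    rw [hv]
    exact blockCoeff_succ_eq_zero (by linarith [hm j])
  rw [block_eq_conv]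
  simp_rw [blockKernel_eq_trigPoly]
  simpa only [zero_smul] using conv_tensor_trigPoly_eq_smul
    (fun j _ => (lipschitzSymbol_blockCoeff (u j)).abs_le_of_ne_zero) hcoeff hF

/-! ### Reconstruction from the blocks -/

/-- The partial sums of the decomposition of a function into blocks. -/
def partialSum (N : ℕ) (f : Torus d → ℂ) : Torus d → ℂ := conv f (tensor fun _ => lowKernel N)

lemma sum_range_blockKernel (N : ℕ) :
    ∑ s ∈ Finset.range (N + 1), blockKernel s = lowKernel N := by
  induction N with
  | zero => rw [zero_add, Finset.sum_range_one, blockKernel_zero]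
  | succ N ih => rw [Finset.sum_range_succ, ih, blockKernel_succ, add_sub_cancel]

lemma partialSum_eq_sum (N : ℕ) {f : Torus d → ℂ} (hf : Integrable f (torusMeasure d)) :
    partialSum N f = ∑ s ∈ Fintype.piFinset fun _ : Fin d => Finset.range (N + 1), block s f := by
  have expand : (tensor fun _ : Fin d => lowKernel N) =
      ∑ s ∈ Fintype.piFinset fun _ : Fin d => Finset.range (N + 1),
        tensor fun j => blockKernel (s j) := by
    ext x
    simp only [tensor, ← sum_range_blockKernel, Finset.sum_apply, Finset.prod_univ_sum]
  rw [partialSum, expand, conv_sum _ hf fun s _ => continuous_tensor fun j => by fun_prop]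
  rfl

lemma continuous_partialSum (N : ℕ) {f : Torus d → ℂ} (hf : Integrable f (torusMeasure d)) :
    Continuous (partialSum N f) :=
  continuous_conv hf (by fun_prop)

lemma partialSum_eq_self {N : ℕ} {M : Fin d → ℕ} (h : ∀ j, 2 * M j ≤ 2 ^ N) {F : Torus d → ℂ}
    (hF : F ∈ trigSpace M) : partialSum N F = F :=
  conv_lowKernel_eq_self h hF

lemma eLpNorm_partialSum_le {p : ℝ≥0∞} (hp : 1 ≤ p) (N : ℕ) {f : Torus d → ℂ}
    (hf : AEStronglyMeasurable f (torusMeasure d)) :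
    eLpNorm (partialSum N f) p (torusMeasure d) ≤ 8 ^ d * eLpNorm f p (torusMeasure d) := by
  refine (eLpNorm_conv_tensor_le hp hf fun _ => continuous_lowKernel N).trans ?_
  gcongr
  rw [Finset.prod_const, Finset.card_univ, Fintype.card_fin]
  gcongr
  exact eLpNorm_one_lowKernel_le N

lemma eLpNorm_partialSum_sub_self_le {p : ℝ≥0∞} (hp : 1 ≤ p) (N : ℕ) {f : Torus d → ℂ}
    (hf : MemLp f p (torusMeasure d)) :
    eLpNorm (partialSum N f - f) p (torusMeasure d) ≤
      (8 ^ d + 1) * eLpNorm f p (torusMeasure d) := by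
  have hc := continuous_partialSum N (hf.integrable hp)
  refine (eLpNorm_sub_le hc.aestronglyMeasurable hf.1 hp).trans ?_
  rw [add_one_mul]
  gcongr
  exact eLpNorm_partialSum_le hp N hf.1

theorem tendsto_eLpNorm_partialSum_sub {p : ℝ≥0∞} (hp1 : 1 ≤ p) (hp : p ≠ ∞) {f : Torus d → ℂ}
    (hf : MemLp f p (torusMeasure d)) :
    Filter.Tendsto (fun N => eLpNorm (partialSum N f - f) p (torusMeasure d)) Filter.atTop
      (nhds 0) := by
  rw [ENNReal.tendsto_nhds_zero]
  intro ε hε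
  obtain ⟨M, F, hF, hfF⟩ := exists_mem_trigSpace_eLpNorm_sub_le hp1 hp hf
    (ε := ε / (8 ^ d + 1)) (ENNReal.div_pos hε.ne' (by finiteness)).ne'
  have hF' : MemLp F p (torusMeasure d) :=
    (continuous_of_mem_trigSpace hF).memLp_of_hasCompactSupport (.of_compactSpace F)
  filter_upwards [Filter.eventually_ge_atTop (2 * ∑ j, M j)] with N hN
  have hself : partialSum N F = F := partialSum_eq_self (fun j => by
    have := Finset.single_le_sum (fun i _ => Nat.zero_le (M i)) (Finset.mem_univ j)
    exact ((Nat.mul_le_mul_left 2 this).trans hN).trans Nat.lt_two_pow_self.le) hF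
  have hsplit : partialSum N f - f = partialSum N (f - F) - (f - F) := by
    have : partialSum N (f - F) = partialSum N f - partialSum N F :=
      sub_conv (hf.integrable hp1) (hF'.integrable hp1) (by fun_prop)
    rw [this, hself, sub_sub_sub_cancel_right]
  calc eLpNorm (partialSum N f - f) p (torusMeasure d)
      ≤ (8 ^ d + 1) * eLpNorm (f - F) p (torusMeasure d) :=
        hsplit ▸ eLpNorm_partialSum_sub_self_le hp1 N (hf.sub hF')
    _ ≤ (8 ^ d + 1) * (ε / (8 ^ d + 1)) := by gcongr
    _ ≤ ε := ENNReal.mul_div_le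

end Torus

/-! ### Nikol'skii inequalities -/

section Marginal

variable {ι : Type*} [DecidableEq ι] {X : ι → Type*} [∀ i, MeasurableSpace (X i)]
  {μ : ∀ i, Measure (X i)}

lemma lmarginal_mul_lmarginal {φ ψ : (∀ i, X i) → ℝ≥0∞} (hφ : Measurable φ) (T : Finset ι) :
    ∫⋯∫⁻_T, φ * (∫⋯∫⁻_T, ψ ∂μ) ∂μ = (∫⋯∫⁻_T, φ ∂μ) * ∫⋯∫⁻_T, ψ ∂μ := by
  ext x
  have hψ (y : ∀ i : T, X i) :
      (∫⋯∫⁻_T, ψ ∂μ) (Function.updateFinset x T y) = (∫⋯∫⁻_T, ψ ∂μ) x :=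
    lmarginal_congr μ ψ fun i hi => by simp [Function.updateFinset, hi]
  calc (∫⋯∫⁻_T, φ * (∫⋯∫⁻_T, ψ ∂μ) ∂μ) x
      = ∫⁻ y, φ (Function.updateFinset x T y) * (∫⋯∫⁻_T, ψ ∂μ) x ∂Measure.pi fun i : T => μ i :=
        lintegral_congr fun y => by rw [Pi.mul_apply, hψ]
    _ = _ := lintegral_mul_const _ (hφ.comp measurable_updateFinset)

theorem lintegral_lmarginal_mul_lmarginal_compl [Fintype ι] [∀ i, SigmaFinite (μ i)]
    {φ ψ : (∀ i, X i) → ℝ≥0∞} (hφ : Measurable φ) (hψ : Measurable ψ) (T : Finset ι) :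
    ∫⁻ x, (∫⋯∫⁻_T, φ ∂μ) x * (∫⋯∫⁻_Tᶜ, ψ ∂μ) x ∂Measure.pi μ =
      (∫⁻ x, φ x ∂Measure.pi μ) * ∫⁻ x, ψ x ∂Measure.pi μ := by
  rcases isEmpty_or_nonempty (∀ i, X i) with _ | ⟨⟨x⟩⟩
  · simp
  have hdisj : Disjoint T Tᶜ := disjoint_compl_right
  have inner : ∫⋯∫⁻_Tᶜ, (∫⋯∫⁻_T, φ ∂μ) * (∫⋯∫⁻_Tᶜ, ψ ∂μ) ∂μ =
      (∫⋯∫⁻_Finset.univ, φ ∂μ) * ∫⋯∫⁻_Tᶜ, ψ ∂μ := by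
    rw [lmarginal_mul_lmarginal (hφ.lmarginal μ), ← lmarginal_union' μ φ hφ hdisj,
      Finset.union_compl]
  have outer : ∫⋯∫⁻_T, (∫⋯∫⁻_Finset.univ, φ ∂μ) * (∫⋯∫⁻_Tᶜ, ψ ∂μ) ∂μ =
      (∫⋯∫⁻_Finset.univ, φ ∂μ) * ∫⋯∫⁻_Finset.univ, ψ ∂μ := by
    rw [← Finset.union_compl T, lmarginal_union μ ψ hψ hdisj, Finset.union_compl, lmarginal_univ]
    ext y
    exact lintegral_const_mul _ ((hψ.lmarginal μ).comp measurable_updateFinset)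
  have key : ∫⋯∫⁻_Finset.univ, (∫⋯∫⁻_T, φ ∂μ) * (∫⋯∫⁻_Tᶜ, ψ ∂μ) ∂μ =
      (∫⋯∫⁻_Finset.univ, φ ∂μ) * ∫⋯∫⁻_Finset.univ, ψ ∂μ := by
    rw [← Finset.union_compl T,
      lmarginal_union μ _ ((hφ.lmarginal μ).mul (hψ.lmarginal μ)) hdisj, inner, outer,
      Finset.union_compl]
  simpa only [lmarginal_univ, Pi.mul_apply] using congrFun key x

end Marginal

section Torus

variable {d : ℕ}

/-- The constant in Nikol'skii's inequality between `L_p` and `L_∞`, `ρ = 1/p`, for trigonometric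
polynomials of degree `2^{s_j}` in the variable `x_j`. -/
def nikolskiiConst (ρ : ℝ) (s : Fin d → ℕ) : ℝ :=
  ∏ j, 8 * (2 : ℝ) ^ (ρ * s j)

lemma one_le_nikolskiiConst {ρ : ℝ} (hρ : 0 ≤ ρ) (s : Fin d → ℕ) : 1 ≤ nikolskiiConst ρ s := by
  refine Finset.prod_induction _ (1 ≤ ·) (fun _ _ => one_le_mul_of_one_le_of_one_le) le_rfl
    fun j _ => ?_
  have := Real.one_le_rpow one_le_two (by positivity : 0 ≤ ρ * s j)
  linarith

lemma prod_rpow_one_div {q : ℝ} (hq : 0 < q) (s : Fin d → ℕ) :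
    (∏ j, (8 : ℝ≥0∞) ^ q * 2 ^ s j) ^ (1 / q) = ENNReal.ofReal (nikolskiiConst (1 / q) s) := by
  rw [nikolskiiConst, ← ENNReal.prod_rpow_of_nonneg (by positivity),
    ENNReal.ofReal_prod_of_nonneg fun j _ => by positivity]
  refine Finset.prod_congr rfl fun j _ => ?_
  rw [ENNReal.mul_rpow_of_nonneg _ _ (by positivity), ← ENNReal.rpow_mul,
    mul_one_div_cancel hq.ne', ENNReal.rpow_one, ← ENNReal.rpow_natCast, ← ENNReal.rpow_mul,
    ENNReal.ofReal_mul (by norm_num), ← ENNReal.ofReal_rpow_of_pos two_pos, mul_comm (1 / q)]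
  norm_num

lemma measurable_enorm_rpow_of_mem_trigSpace {N : Fin d → ℕ} {F : Torus d → ℂ}
    (hF : F ∈ trigSpace N) (q : ℝ) : Measurable fun x => ‖F x‖ₑ ^ q :=
  (continuous_of_mem_trigSpace hF).enorm.measurable.pow_const q

section Nikolskii

variable {s s' : Fin d → ℕ} {F G : Torus d → ℂ}

theorem enorm_rpow_le_lmarginal {q : ℝ} (hq : 1 ≤ q) (hF : F ∈ trigSpace fun j => 2 ^ s j)
    (T : Finset (Fin d)) (x : Torus d) :
    ‖F x‖ₑ ^ q ≤ (∏ j ∈ T, 8 ^ q * 2 ^ s j) *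
      (∫⋯∫⁻_T, (‖F ·‖ₑ ^ q) ∂fun _ => AddCircle.haarAddCircle) x := by
  have hm := measurable_enorm_rpow_of_mem_trigSpace hF q
  induction T using Finset.induction_on generalizing x with
  | empty => simp
  | insert j T hj ih =>
    obtain ⟨c, hc⟩ := exists_trigPoly_eq_update hF j x
    have one_variable : ‖F x‖ₑ ^ q ≤
        8 ^ q * 2 ^ s j * ∫⁻ y, ‖F (Function.update x j y)‖ₑ ^ q ∂AddCircle.haarAddCircle := by
      simpa only [← hc, Function.update_eq_self] using enorm_trigPoly_rpow_le hq (s j) c (x j)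
    rw [Finset.prod_insert hj, lmarginal_insert _ hm hj, mul_assoc,
      ← lintegral_const_mul' _ _ (ENNReal.prod_ne_top fun i _ => by finiteness)]
    exact one_variable.trans (by gcongr with y; exact ih _)

lemma lintegral_enorm_mul_rpow_le {q : ℝ} (hq : 1 ≤ q) (hF : F ∈ trigSpace fun j => 2 ^ s j)
    (hG : G ∈ trigSpace fun j => 2 ^ s' j) :
    ∫⁻ x, ‖(F * G) x‖ₑ ^ q ∂torusMeasure d ≤ (∏ j, 8 ^ q * 2 ^ min (s j) (s' j)) *
      ((∫⁻ x, ‖F x‖ₑ ^ q ∂torusMeasure d) * ∫⁻ x, ‖G x‖ₑ ^ q ∂torusMeasure d) := by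
  have hFm := measurable_enorm_rpow_of_mem_trigSpace hF q
  have hGm := measurable_enorm_rpow_of_mem_trigSpace hG q
  -- Each factor is averaged over the variables in which its degree is the smaller one.
  set T : Finset (Fin d) := {j | s j ≤ s' j} with hT
  have hprod : (∏ j ∈ T, (8 : ℝ≥0∞) ^ q * 2 ^ s j) * (∏ j ∈ Tᶜ, (8 : ℝ≥0∞) ^ q * 2 ^ s' j) =
      ∏ j, (8 : ℝ≥0∞) ^ q * 2 ^ min (s j) (s' j) := by
    rw [← Finset.prod_mul_prod_compl T]
    congr 1 <;> refine Finset.prod_congr rfl fun j hj => ?_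
    · rw [min_eq_left (by simpa [hT] using hj)]
    · rw [min_eq_right (le_of_lt (by simpa [hT] using hj))]
  have hpointwise (x : Torus d) : ‖(F * G) x‖ₑ ^ q ≤ (∏ j, 8 ^ q * 2 ^ min (s j) (s' j)) *
      ((∫⋯∫⁻_T, (‖F ·‖ₑ ^ q) ∂fun _ => AddCircle.haarAddCircle) x *
        (∫⋯∫⁻_Tᶜ, (‖G ·‖ₑ ^ q) ∂fun _ => AddCircle.haarAddCircle) x) := by
    rw [Pi.mul_apply, enorm_mul, ENNReal.mul_rpow_of_nonneg _ _ (by positivity), ← hprod,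
      mul_mul_mul_comm]
    exact mul_le_mul' (enorm_rpow_le_lmarginal hq hF T x) (enorm_rpow_le_lmarginal hq hG Tᶜ x)
  refine (lintegral_mono hpointwise).trans_eq ?_
  rw [lintegral_const_mul, torusMeasure, lintegral_lmarginal_mul_lmarginal_compl hFm hGm]
  exact (hFm.lmarginal _).mul (hGm.lmarginal _)

variable {p : ℝ≥0∞}

theorem eLpNorm_top_le (hp : 1 ≤ p) (hF : F ∈ trigSpace fun j => 2 ^ s j) :
    eLpNorm F ∞ (torusMeasure d) ≤
      ENNReal.ofReal (nikolskiiConst (1 / p).toReal s) * eLpNorm F p (torusMeasure d) := by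
  rcases eq_or_ne p ∞ with rfl | hpt
  · exact le_mul_of_one_le_left zero_le
      (ENNReal.one_le_ofReal.2 (one_le_nikolskiiConst ENNReal.toReal_nonneg s))
  have hq : 1 ≤ p.toReal := by simpa using ENNReal.toReal_mono hpt hp
  have hq0 : 0 < p.toReal := by positivity
  rw [ENNReal.toReal_div, ENNReal.toReal_one, ← prod_rpow_one_div hq0,
    eLpNorm_eq_lintegral_rpow_enorm_toReal (by positivity) hpt,
    ← ENNReal.mul_rpow_of_nonneg _ _ (by positivity), eLpNorm_exponent_top]
  refine essSup_le_of_ae_le _ (.of_forall fun x => ?_)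
  simpa only [one_div, ENNReal.le_rpow_inv_iff hq0, lmarginal_univ, torusMeasure] using
    enorm_rpow_le_lmarginal hq hF Finset.univ x

theorem eLpNorm_mul_le (hp : 1 ≤ p) (hF : F ∈ trigSpace fun j => 2 ^ s j)
    (hG : G ∈ trigSpace fun j => 2 ^ s' j) :
    eLpNorm (F * G) p (torusMeasure d) ≤
      ENNReal.ofReal (nikolskiiConst (1 / p).toReal (s ⊓ s')) *
        (eLpNorm F p (torusMeasure d) * eLpNorm G p (torusMeasure d)) := by
  rcases eq_or_ne p ∞ with rfl | hpt
  · refine (eLpNorm_smul_le_eLpNorm_top_mul_eLpNorm ∞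
      (continuous_of_mem_trigSpace hG).aestronglyMeasurable F).trans ?_
    exact le_mul_of_one_le_left zero_le
      (ENNReal.one_le_ofReal.2 (one_le_nikolskiiConst ENNReal.toReal_nonneg _))
  have hq : 1 ≤ p.toReal := by simpa using ENNReal.toReal_mono hpt hp
  have hq0 : 0 < p.toReal := by positivity
  simp_rw [eLpNorm_eq_lintegral_rpow_enorm_toReal (show p ≠ 0 by positivity) hpt]
  rw [ENNReal.toReal_div, ENNReal.toReal_one, ← prod_rpow_one_div hq0,
    ← ENNReal.mul_rpow_of_nonneg _ _ (by positivity),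
    ← ENNReal.mul_rpow_of_nonneg _ _ (by positivity)]
  gcongr
  exact lintegral_enorm_mul_rpow_le hq hF hG

end Nikolskii

end Torus

/-! ### Geometric sums -/

/-- The sum of the geometric series `∑_{a ≥ 0} 2^{-εa}`. -/
def geom (ε : ℝ) : ℝ := (1 - (2 : ℝ) ^ (-ε))⁻¹

section geom

variable {ε r : ℝ}

lemma two_rpow_neg_lt_one (hε : 0 < ε) : (2 : ℝ) ^ (-ε) < 1 :=
  Real.rpow_lt_one_of_one_lt_of_neg one_lt_two (neg_neg_of_pos hε)

lemma geom_pos (hε : 0 < ε) : 0 < geom ε :=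
  inv_pos.2 (sub_pos.2 (two_rpow_neg_lt_one hε))

lemma geom_mul_add_one (hε : 0 < ε) : geom ε * (2 : ℝ) ^ (-ε) + 1 = geom ε := by
  have : 1 - (2 : ℝ) ^ (-ε) ≠ 0 := (sub_pos.2 (two_rpow_neg_lt_one hε)).ne'
  rw [geom]
  field_simp
  ring

lemma sum_two_rpow_int_le (hε : 0 < ε) {M : ℝ} (hM : 0 ≤ M) {S : Finset ℤ}
    (hS : ∀ k ∈ S, (2 : ℝ) ^ (ε * k) ≤ M) : ∑ k ∈ S, (2 : ℝ) ^ (ε * k) ≤ geom ε * M := by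
  induction S using Finset.induction_on_max generalizing M with
  | empty => simpa using mul_nonneg (geom_pos hε).le hM
  | insert n S hn ih =>
    have hsmaller (k) (hk : k ∈ S) : (2 : ℝ) ^ (ε * k) ≤ 2 ^ (-ε) * 2 ^ (ε * n) := by
      rw [← Real.rpow_add two_pos]
      have : (k : ℝ) + 1 ≤ n := by exact_mod_cast hn k hk
      exact Real.rpow_le_rpow_of_exponent_le one_le_two (by nlinarith)
    rw [Finset.sum_insert fun h => (hn n h).false]
    calc (2 : ℝ) ^ (ε * n) + ∑ k ∈ S, (2 : ℝ) ^ (ε * k)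
        ≤ 2 ^ (ε * n) + geom ε * (2 ^ (-ε) * 2 ^ (ε * n)) := by
          gcongr
          exact ih (by positivity) hsmaller
      _ = geom ε * 2 ^ (ε * n) := by linear_combination 2 ^ (ε * n) * geom_mul_add_one hε
      _ ≤ geom ε * M :=
          mul_le_mul_of_nonneg_left (hS n (Finset.mem_insert_self n S)) (geom_pos hε).le

lemma sum_two_rpow_le (hε : 0 < ε) {M : ℝ} (hM : 0 ≤ M) {S : Finset ℕ}
    (hS : ∀ a ∈ S, (2 : ℝ) ^ (ε * a) ≤ M) : ∑ a ∈ S, (2 : ℝ) ^ (ε * a) ≤ geom ε * M := by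
  simpa using sum_two_rpow_int_le hε hM (S := S.map ⟨_, Nat.cast_injective⟩) (by simpa using hS)

lemma sum_two_rpow_neg_le (hr : 0 < r) {M : ℝ} (hM : 0 ≤ M) {S : Finset ℕ}
    (hS : ∀ a ∈ S, (2 : ℝ) ^ (-r * a) ≤ M) : ∑ a ∈ S, (2 : ℝ) ^ (-r * a) ≤ geom r * M := by
  have hinj : Function.Injective fun a : ℕ => -(a : ℤ) := neg_injective.comp Nat.cast_injective
  simpa using sum_two_rpow_int_le hr hM (S := S.map ⟨_, hinj⟩) (by simpa using hS)

lemma sum_two_rpow_neg_le_geom (hr : 0 < r) (S : Finset ℕ) :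
    ∑ a ∈ S, (2 : ℝ) ^ (-r * a) ≤ geom r := by
  simpa using sum_two_rpow_neg_le hr zero_le_one (S := S) fun a _ =>
    Real.rpow_le_one_of_one_le_of_nonpos one_le_two (by nlinarith [(a.cast_nonneg : (0 : ℝ) ≤ a)])

lemma sum_two_rpow_neg_tail_le (hr : 0 < r) (u : ℕ) (S : Finset ℕ) :
    ∑ a ∈ S, (if u ≤ a + 2 then (2 : ℝ) ^ (-r * a) else 0) ≤ geom r * (4 ^ r * 2 ^ (-r * u)) := by
  rw [← Finset.sum_filter]
  refine sum_two_rpow_neg_le hr (by positivity) fun a ha => ?_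
  have hua : (u : ℝ) ≤ a + 2 := by exact_mod_cast (Finset.mem_filter.1 ha).2
  rw [show (4 : ℝ) = 2 ^ (2 : ℝ) by norm_num, ← Real.rpow_mul two_pos.le, ← Real.rpow_add two_pos]
  exact Real.rpow_le_rpow_of_exponent_le one_le_two (by nlinarith)

lemma sum_min_pow_mul_two_rpow_le {l : ℕ} (hr : 0 < r) (hl : r < l) {τ : ℝ} (hτ : 0 ≤ τ)
    (S : Finset ℕ) :
    ∑ a ∈ S, min 1 (2 ^ a * τ) ^ l * (2 : ℝ) ^ (-r * a) ≤ (geom (l - r) + geom r) * τ ^ r := by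
  rcases hτ.eq_or_lt with rfl | hτ
  · have : l ≠ 0 := by rintro rfl; exact (hr.trans hl).ne' Nat.cast_zero
    simp [this, Real.zero_rpow hr.ne']
  have hpow (a : ℕ) (x : ℝ) : (2 : ℝ) ^ (x * a) = ((2 : ℝ) ^ a) ^ x := by
    rw [mul_comm, Real.rpow_mul two_pos.le, Real.rpow_natCast]
  rw [add_mul, ← Finset.sum_filter_add_sum_filter_not S fun a => 2 ^ a * τ ≤ 1]
  gcongr
  · calc ∑ a ∈ S with 2 ^ a * τ ≤ 1, min 1 (2 ^ a * τ) ^ l * (2 : ℝ) ^ (-r * a)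
        = ∑ a ∈ S with 2 ^ a * τ ≤ 1, τ ^ l * (2 : ℝ) ^ ((l - r) * a) := by
          refine Finset.sum_congr rfl fun a ha => ?_
          rw [min_eq_right (Finset.mem_filter.1 ha).2, mul_pow, sub_eq_add_neg, add_mul,
            Real.rpow_add two_pos, hpow a l, Real.rpow_natCast]
          ring
      _ ≤ τ ^ l * (geom (l - r) * τ⁻¹ ^ (l - r)) := by
          rw [← Finset.mul_sum]
          gcongr
          refine sum_two_rpow_le (sub_pos.2 hl) (by positivity) fun a ha => ?_
          rw [hpow]
          have := (le_div_iff₀ hτ).2 (Finset.mem_filter.1 ha).2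
          rw [one_div] at this
          have := sub_pos.2 hl
          gcongr
      _ = geom (l - r) * τ ^ r := by
          rw [Real.inv_rpow hτ.le, ← Real.rpow_neg hτ.le, mul_left_comm, ← Real.rpow_natCast,
            ← Real.rpow_add hτ]
          ring_nf
  · calc ∑ a ∈ S with ¬2 ^ a * τ ≤ 1, min 1 (2 ^ a * τ) ^ l * (2 : ℝ) ^ (-r * a)
        ≤ ∑ a ∈ S with ¬2 ^ a * τ ≤ 1, (2 : ℝ) ^ (-r * a) :=
          Finset.sum_le_sum fun a _ => mul_le_of_le_one_left (by positivity)
            (pow_le_one₀ (by positivity) (min_le_left _ _))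
      _ ≤ geom r * τ ^ r := by
          refine sum_two_rpow_neg_le hr (by positivity) fun a ha => ?_
          have : τ⁻¹ ≤ 2 ^ a := by
            rw [← one_div, div_le_iff₀ hτ]
            exact (not_le.1 (Finset.mem_filter.1 ha).2).le
          rw [hpow, Real.rpow_neg (by positivity), ← Real.inv_rpow (by positivity)]
          gcongr
          exact inv_le_of_inv_le₀ hτ this

end geom

section LimitsAndSums

variable {α E : Type*} [MeasurableSpace α] {μ : Measure α} [NormedAddCommGroup E]

lemma eLpNorm_le_of_tendsto_eLpNorm_sub {p q C : ℝ≥0∞} (hq : q ≠ 0) {F : ℕ → α → E} {f : α → E}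
    (hF : ∀ n, AEStronglyMeasurable (F n) μ) (hf : AEStronglyMeasurable f μ)
    (hlim : Filter.Tendsto (fun n => eLpNorm (F n - f) q μ) Filter.atTop (nhds 0))
    (hC : ∀ n, eLpNorm (F n) p μ ≤ C) : eLpNorm f p μ ≤ C :=
  eLpNorm_le_of_tendstoInMeasure (.of_forall hC)
    (tendstoInMeasure_of_tendsto_eLpNorm hq hF hf hlim) hF

lemma eLpNorm_mul_le_eLpNorm_top_mul_eLpNorm (p : ℝ≥0∞) (f : α → ℂ) {g : α → ℂ}
    (hg : AEStronglyMeasurable g μ) : eLpNorm (f * g) p μ ≤ eLpNorm f ∞ μ * eLpNorm g p μ :=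
  eLpNorm_smul_le_eLpNorm_top_mul_eLpNorm p hg f

lemma tendsto_eLpNorm_mul_sub_mul {F G : ℕ → α → ℂ} {f g : α → ℂ} {A B : ℝ≥0∞}
    (hF : ∀ n, AEStronglyMeasurable (F n) μ) (hG : ∀ n, AEStronglyMeasurable (G n) μ)
    (hf : AEStronglyMeasurable f μ) (hg : AEStronglyMeasurable g μ) (hA : A ≠ ∞) (hB : B ≠ ∞)
    (hFA : ∀ n, eLpNorm (F n) ∞ μ ≤ A) (hgB : eLpNorm g ∞ μ ≤ B)
    (hFf : Filter.Tendsto (fun n => eLpNorm (F n - f) 1 μ) Filter.atTop (nhds 0))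
    (hGg : Filter.Tendsto (fun n => eLpNorm (G n - g) 1 μ) Filter.atTop (nhds 0)) :
    Filter.Tendsto (fun n => eLpNorm (F n * G n - f * g) 1 μ) Filter.atTop (nhds 0) := by
  have hlim := (ENNReal.Tendsto.const_mul hGg (.inr hA)).add
    (ENNReal.Tendsto.const_mul hFf (.inr hB))
  rw [mul_zero, mul_zero, add_zero] at hlim
  refine tendsto_of_tendsto_of_tendsto_of_le_of_le tendsto_const_nhds hlim (fun _ => zero_le)
    fun n => ?_
  have split : F n * G n - f * g = F n * (G n - g) + g * (F n - f) := by
    rw [mul_sub, mul_sub, mul_comm g (F n), mul_comm g f, sub_add_sub_cancel]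
  have hGn := (hG n).sub hg
  have hFn := (hF n).sub hf
  calc eLpNorm (F n * G n - f * g) 1 μ
      ≤ eLpNorm (F n * (G n - g)) 1 μ + eLpNorm (g * (F n - f)) 1 μ := by
        rw [split]
        exact eLpNorm_add_le ((hF n).mul hGn) (hg.mul hFn) le_rfl
    _ ≤ eLpNorm (F n) ∞ μ * eLpNorm (G n - g) 1 μ + eLpNorm g ∞ μ * eLpNorm (F n - f) 1 μ :=
        add_le_add (eLpNorm_mul_le_eLpNorm_top_mul_eLpNorm 1 _ hGn)
          (eLpNorm_mul_le_eLpNorm_top_mul_eLpNorm 1 _ hFn)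
    _ ≤ A * eLpNorm (G n - g) 1 μ + B * eLpNorm (F n - f) 1 μ :=
        add_le_add (mul_le_mul_left (hFA n) _) (mul_le_mul_left hgB _)

theorem eLpNorm_sum_piFinset_le {ι κ : Type*} [Fintype ι] [DecidableEq ι] {p : ℝ≥0∞} (hp : 1 ≤ p)
    (S : Finset κ) {F : (ι → κ) → α → E} (hF : ∀ s, AEStronglyMeasurable (F s) μ) {B : ℝ}
    {w : ι → κ → ℝ} (hw : ∀ i a, 0 ≤ w i a) {D : ι → ℝ}
    (hFw : ∀ s, eLpNorm (F s) p μ ≤ ENNReal.ofReal (B * ∏ i, w i (s i)))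
    (hD : ∀ i, ∑ a ∈ S, w i a ≤ D i) :
    eLpNorm (∑ s ∈ Fintype.piFinset fun _ : ι => S, F s) p μ ≤ ENNReal.ofReal (B * ∏ i, D i) := by
  have hprod (s : ι → κ) : 0 ≤ ∏ i, w i (s i) := Finset.prod_nonneg fun i _ => hw i _
  have hsum (i : ι) : 0 ≤ ∑ a ∈ S, w i a := Finset.sum_nonneg fun a _ => hw i a
  calc eLpNorm (∑ s ∈ Fintype.piFinset fun _ : ι => S, F s) p μ
      ≤ ∑ s ∈ Fintype.piFinset fun _ : ι => S, ENNReal.ofReal (B * ∏ i, w i (s i)) :=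
        (eLpNorm_sum_le (fun s _ => hF s) hp).trans (Finset.sum_le_sum fun s _ => hFw s)
    _ = ENNReal.ofReal B * ENNReal.ofReal (∏ i, ∑ a ∈ S, w i a) := by
        simp_rw [ENNReal.ofReal_mul' (hprod _)]
        rw [← Finset.mul_sum, ← ENNReal.ofReal_sum_of_nonneg fun s _ => hprod s,
          Finset.prod_univ_sum]
    _ ≤ ENNReal.ofReal B * ENNReal.ofReal (∏ i, D i) := by
        gcongr with i
        · exact fun i _ => hsum i
        · exact hD i
    _ = ENNReal.ofReal (B * ∏ i, D i) :=
        (ENNReal.ofReal_mul' (Finset.prod_nonneg fun i _ => (hsum i).trans (hD i))).symm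

end LimitsAndSums

section Torus

variable {d : ℕ}

lemma two_rpow_mul_sum (r : ℝ) (s : Fin d → ℕ) :
    (2 : ℝ) ^ (-r * ∑ j, (s j : ℝ)) = ∏ j, (2 : ℝ) ^ (-r * s j) := by
  rw [Finset.mul_sum, Real.rpow_sum_of_pos two_pos]

lemma eLpNorm_block_le {p : ℝ≥0∞} (hp : 1 ≤ p) (s : Fin d → ℕ) {f : Torus d → ℂ}
    (hf : AEStronglyMeasurable f (torusMeasure d)) :
    eLpNorm (block s f) p (torusMeasure d) ≤ 24 ^ d * eLpNorm f p (torusMeasure d) := by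
  refine (eLpNorm_conv_tensor_le hp hf fun j => continuous_blockKernel (s j)).trans ?_
  gcongr
  exact (Finset.prod_le_pow_card _ _ _ fun j _ => eLpNorm_one_blockKernel_le (s j)).trans_eq
    (by rw [Finset.card_univ, Fintype.card_fin])

lemma continuous_block (s : Fin d → ℕ) {f : Torus d → ℂ} (hf : Integrable f (torusMeasure d)) :
    Continuous (block s f) :=
  continuous_of_mem_trigSpace (block_mem_trigSpace s hf)

lemma block_mixedDiff (s : Fin d → ℕ) {f : Torus d → ℂ} (hf : Integrable f (torusMeasure d))
    (l : ℕ) (t : Fin d → ℝ) (e : Finset (Fin d)) :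
    block s (mixedDiff l t e f) = mixedDiff l t e (block s f) :=
  mixedDiff_conv hf (continuous_tensor fun j => continuous_blockKernel (s j)) l t e

/-! ### Comparison of the two classes -/

lemma exists_diffFactor_eq_blockKernel (l : ℕ) (s : Fin d → ℕ) :
    ∃ K : Fin d → AddCircle (2 * π) → ℂ, (∀ j, Continuous (K j)) ∧
      (∀ j, eLpNorm (K j) 1 AddCircle.haarAddCircle ≤ ENNReal.ofReal (24 * 56 ^ l)) ∧
      diffFactor l (fun j => ((2 : ℝ) ^ s j)⁻¹) {j | s j ≠ 0} K = fun j => blockKernel (s j) := by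
  have one_variable (a : ℕ) : ∃ K, Continuous K ∧
      eLpNorm K 1 AddCircle.haarAddCircle ≤ ENNReal.ofReal (24 * 56 ^ l) ∧
      (if a ≠ 0 then (fwdDiff ((((2 : ℝ) ^ a)⁻¹ : ℝ) : AddCircle (2 * π)))^[l] K else K) =
        blockKernel a := by
    cases a with
    | zero =>
      refine ⟨blockKernel 0, continuous_blockKernel 0, ?_, if_neg (by simp)⟩
      refine (eLpNorm_one_blockKernel_le 0).trans ?_
      rw [← ENNReal.ofReal_ofNat]
      gcongr
      exact le_mul_of_one_le_right (by norm_num) (one_le_pow₀ (by norm_num))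
    | succ a => simpa using exists_iterate_fwdDiff_eq_blockKernel l a
  choose K hcont hnorm heq using one_variable
  refine ⟨fun j => K (s j), fun j => hcont _, fun j => hnorm _, ?_⟩
  ext1 j
  simpa [diffFactor] using heq (s j)

/-- Jackson's inequality. -/
theorem hClassOrder_subset_hBlockClass {p : ℝ≥0∞} (hp : 1 ≤ p) (r : ℝ) (l : ℕ) (B : ℝ) :
    hClassOrder d r p l B ⊆ hBlockClass d r p ((24 * 56 ^ l) ^ d * B) := by
  refine fun f hf => ⟨hf.1, fun s => ?_⟩
  obtain ⟨K, hcont, hnorm, hdiff⟩ := exists_diffFactor_eq_blockKernel l s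
  set t : Fin d → ℝ := fun j => ((2 : ℝ) ^ s j)⁻¹ with ht
  set e : Finset (Fin d) := {j | s j ≠ 0} with he
  have hf_int : Integrable f (torusMeasure d) := hf.1.integrable hp
  have hblock : block s f = conv (mixedDiff l t e f) (tensor K) := by
    rw [block_eq_conv, ← hdiff, ← mixedDiff_tensor, conv_mixedDiff hf_int (continuous_tensor hcont),
      mixedDiff_conv hf_int (continuous_tensor hcont)]
  have hsteps : ∏ j ∈ e, |t j| ^ r = (2 : ℝ) ^ (-r * ∑ j, (s j : ℝ)) := by
    rw [two_rpow_mul_sum, he, Finset.prod_filter]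
    refine Finset.prod_congr rfl fun j _ => ?_
    rw [ht, abs_of_pos (by positivity), Real.inv_rpow (by positivity), ← Real.rpow_natCast,
      ← Real.rpow_mul two_pos.le, ← Real.rpow_neg two_pos.le, mul_comm (s j : ℝ), neg_mul]
    split_ifs with h
    · rfl
    · simp [not_not.1 h]
  calc eLpNorm (block s f) p (torusMeasure d)
      ≤ (∏ j, eLpNorm (K j) 1 AddCircle.haarAddCircle) *
          eLpNorm (mixedDiff l t e f) p (torusMeasure d) := by
        rw [hblock]
        exact eLpNorm_conv_tensor_le hp (memLp_mixedDiff hf.1 l t e).1 hcont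
    _ ≤ ENNReal.ofReal (24 * 56 ^ l) ^ d *
          ENNReal.ofReal (B * (2 : ℝ) ^ (-r * ∑ j, (s j : ℝ))) := by
        gcongr
        · exact (Finset.prod_le_pow_card _ _ _ fun j _ => hnorm j).trans_eq
            (by rw [Finset.card_univ, Fintype.card_fin])
        · rw [← hsteps]
          exact hf.2 e t
    _ = ENNReal.ofReal ((24 * 56 ^ l) ^ d * B * (2 : ℝ) ^ (-r * ∑ j, (s j : ℝ))) := by
        rw [← ENNReal.ofReal_pow (by positivity), ← ENNReal.ofReal_mul (by positivity), mul_assoc]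

/-- The factor contributed by the variable `x_j` to the norm of `Δ_𝐭^l(e)` on trigonometric
polynomials of degree `2^a` in `x_j`. -/
def bernsteinFactor (l : ℕ) (t : Fin d → ℝ) (e : Finset (Fin d)) (j : Fin d) (a : ℕ) : ℝ :=
  if j ∈ e then 8 * 2 ^ l * min 1 (2 ^ a * (2 * |t j|)) ^ l else 8

/-- The constant, per variable, in the Bernstein inequality for the classes of smoothness `r`. -/
def bernsteinConst (r : ℝ) (l : ℕ) : ℝ := 8 * 2 ^ l * 2 ^ r * (geom (l - r) + geom r)

lemma bernsteinConst_pos {r : ℝ} {l : ℕ} (hr : 0 < r) (hl : r < l) : 0 < bernsteinConst r l := by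
  have := geom_pos hr
  have := geom_pos (sub_pos.2 hl)
  unfold bernsteinConst
  positivity

section Bernstein

variable (l : ℕ) (t : Fin d → ℝ) (e : Finset (Fin d))

lemma bernsteinFactor_nonneg (j : Fin d) (a : ℕ) : 0 ≤ bernsteinFactor l t e j a := by
  unfold bernsteinFactor
  split_ifs <;> positivity

lemma eLpNorm_one_diffFactor_lowKernel_le (s : Fin d → ℕ) (j : Fin d) :
    eLpNorm (diffFactor l t e (fun j => lowKernel (s j + 1)) j) 1 AddCircle.haarAddCircle ≤
      ENNReal.ofReal (bernsteinFactor l t e j (s j)) := by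
  unfold diffFactor bernsteinFactor
  split_ifs
  · simpa only [pow_succ, mul_assoc] using
      eLpNorm_one_iterate_fwdDiff_lowKernel_le l (s j + 1) (t j)
  · simpa using eLpNorm_one_lowKernel_le (s j + 1)

theorem eLpNorm_mixedDiff_le_of_mem_trigSpace {p : ℝ≥0∞} (hp : 1 ≤ p) {s : Fin d → ℕ}
    {F : Torus d → ℂ} (hF : F ∈ trigSpace fun j => 2 ^ s j) :
    eLpNorm (mixedDiff l t e F) p (torusMeasure d) ≤
      ENNReal.ofReal (∏ j, bernsteinFactor l t e j (s j)) * eLpNorm F p (torusMeasure d) := by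
  have hF_cont := continuous_of_mem_trigSpace hF
  have hlow : Continuous (tensor fun j : Fin d => lowKernel (s j + 1)) :=
    continuous_tensor fun j => continuous_lowKernel _
  have hrepr : mixedDiff l t e F =
      conv F (tensor (diffFactor l t e fun j => lowKernel (s j + 1))) := by
    rw [← mixedDiff_tensor, conv_mixedDiff (integrable_of_continuous hF_cont) hlow,
      conv_lowKernel_eq_self (s := fun j => s j + 1) (fun j => by rw [pow_succ']) hF]
  have hcont := continuous_diffFactor l t e fun j => continuous_lowKernel (s j + 1)
  rw [hrepr, ENNReal.ofReal_prod_of_nonneg fun j _ => bernsteinFactor_nonneg l t e j _]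
  refine (eLpNorm_conv_tensor_le hp hF_cont.aestronglyMeasurable hcont).trans ?_
  gcongr with j
  exact eLpNorm_one_diffFactor_lowKernel_le l t e s j

lemma sum_bernsteinFactor_le {r : ℝ} (hr : 0 < r) (hl : r < l) (j : Fin d) (S : Finset ℕ) :
    ∑ a ∈ S, bernsteinFactor l t e j a * (2 : ℝ) ^ (-r * a) ≤
      bernsteinConst r l * if j ∈ e then |t j| ^ r else 1 := by
  have hgeom := geom_pos hr
  have hgeom' := geom_pos (sub_pos.2 hl)
  unfold bernsteinFactor bernsteinConst
  split_ifs
  · simp_rw [mul_assoc (8 * 2 ^ l : ℝ)]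
    rw [← Finset.mul_sum]
    gcongr
    refine (sum_min_pow_mul_two_rpow_le hr hl (by positivity) S).trans_eq ?_
    rw [Real.mul_rpow two_pos.le (abs_nonneg _)]
    ring
  · rw [← Finset.mul_sum, mul_one]
    have hpow : (1 : ℝ) ≤ 2 ^ l * 2 ^ r :=
      one_le_mul_of_one_le_of_one_le (one_le_pow₀ one_le_two) (Real.one_le_rpow one_le_two hr.le)
    calc 8 * ∑ a ∈ S, (2 : ℝ) ^ (-r * a)
        ≤ 8 * (geom (l - r) + geom r) := by
          gcongr
          exact (sum_two_rpow_neg_le_geom hr S).trans (le_add_of_nonneg_left hgeom'.le)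
      _ ≤ 8 * (2 ^ l * 2 ^ r) * (geom (l - r) + geom r) := by
          gcongr
          exact le_mul_of_one_le_right (by norm_num) hpow
      _ = 8 * 2 ^ l * 2 ^ r * (geom (l - r) + geom r) := by ring

lemma eLpNorm_block_mixedDiff_le {p : ℝ≥0∞} (hp : 1 ≤ p) {r B : ℝ} {f : Torus d → ℂ}
    (hf : f ∈ hBlockClass d r p B) (s : Fin d → ℕ) :
    eLpNorm (block s (mixedDiff l t e f)) p (torusMeasure d) ≤
      ENNReal.ofReal (B * ∏ j, bernsteinFactor l t e j (s j) * (2 : ℝ) ^ (-r * s j)) := by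
  have hf_int : Integrable f (torusMeasure d) := hf.1.integrable hp
  have hprod : 0 ≤ ∏ j, bernsteinFactor l t e j (s j) :=
    Finset.prod_nonneg fun j _ => bernsteinFactor_nonneg l t e j _
  rw [block_mixedDiff s hf_int, Finset.prod_mul_distrib, mul_left_comm, ENNReal.ofReal_mul hprod,
    ← two_rpow_mul_sum]
  exact (eLpNorm_mixedDiff_le_of_mem_trigSpace l t e hp (block_mem_trigSpace s hf_int)).trans
    (mul_le_mul_right (hf.2 s) _)

end Bernstein

theorem hBlockClass_subset_hClassOrder {p : ℝ≥0∞} (hp : 1 ≤ p) {r : ℝ} (hr : 0 < r) {l : ℕ}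
    (hl : r < l) (B : ℝ) :
    hBlockClass d r p B ⊆ hClassOrder d r p l (bernsteinConst r l ^ d * B) := by
  refine fun f hf => ⟨hf.1, fun e t => ?_⟩
  have hdiff := memLp_mixedDiff (hf.1.mono_exponent hp) l t e
  have hdiff_int := memLp_one_iff_integrable.1 hdiff
  refine eLpNorm_le_of_tendsto_eLpNorm_sub one_ne_zero
    (fun N => (continuous_partialSum N hdiff_int).aestronglyMeasurable) hdiff.1
    (tendsto_eLpNorm_partialSum_sub le_rfl ENNReal.one_ne_top hdiff) fun N => ?_
  have hconst : B * ∏ j, (bernsteinConst r l * if j ∈ e then |t j| ^ r else 1) =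
      bernsteinConst r l ^ d * B * ∏ j ∈ e, |t j| ^ r := by
    rw [Finset.prod_mul_distrib, Finset.prod_const, Finset.card_univ, Fintype.card_fin,
      Finset.prod_ite_mem, Finset.univ_inter]
    ring
  rw [partialSum_eq_sum N hdiff_int, ← hconst]
  exact eLpNorm_sum_piFinset_le hp (Finset.range (N + 1))
    (fun s => (continuous_block s hdiff_int).aestronglyMeasurable)
    (w := fun j a => bernsteinFactor l t e j a * (2 : ℝ) ^ (-r * a))
    (fun j a => mul_nonneg (bernsteinFactor_nonneg l t e j a) (by positivity))
    (eLpNorm_block_mixedDiff_le l t e hp hf) fun j => sum_bernsteinFactor_le l t e hr hl j _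

end Torus

/-! ### Products -/

/-- The bound, per variable, for the block of index `u` of the product of two blocks of indices
`σ.1` and `σ.2`, up to a constant; here `ρ = 1/p`. -/
def pairWeight (r ρ : ℝ) (u : ℕ) (σ : ℕ × ℕ) : ℝ :=
  if u ≤ max σ.1 σ.2 + 2 then
    (2 : ℝ) ^ (ρ * (min σ.1 σ.2 : ℕ)) * ((2 : ℝ) ^ (-r * σ.1) * (2 : ℝ) ^ (-r * σ.2))
  else 0

section pairWeight

variable {r ρ : ℝ}

lemma pairWeight_nonneg (u : ℕ) (σ : ℕ × ℕ) : 0 ≤ pairWeight r ρ u σ := by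
  unfold pairWeight
  split_ifs <;> positivity

lemma pairWeight_swap (u : ℕ) (σ : ℕ × ℕ) : pairWeight r ρ u σ.swap = pairWeight r ρ u σ := by
  simp only [pairWeight, Prod.fst_swap, Prod.snd_swap, max_comm, min_comm, mul_comm]

lemma pairWeight_of_le {u : ℕ} {σ : ℕ × ℕ} (h : σ.1 ≤ σ.2) :
    pairWeight r ρ u σ = (2 : ℝ) ^ (-(r - ρ) * σ.1) *
      if u ≤ σ.2 + 2 then (2 : ℝ) ^ (-r * σ.2) else 0 := by
  rw [pairWeight, max_eq_right h, min_eq_left h, mul_ite, mul_zero, ← mul_assoc,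
    ← Real.rpow_add two_pos]
  ring_nf

lemma sum_pairWeight_le (hρ : 0 ≤ ρ) (hr : ρ < r) (u : ℕ) (S : Finset ℕ) :
    ∑ σ ∈ S ×ˢ S, pairWeight r ρ u σ ≤
      2 * (geom (r - ρ) * (geom r * 4 ^ r)) * 2 ^ (-r * u) := by
  set X : ℕ → ℝ := fun a => (2 : ℝ) ^ (-(r - ρ) * a)
  set Y : ℕ → ℝ := fun b => if u ≤ b + 2 then (2 : ℝ) ^ (-r * b) else 0 with hY
  have hY_nonneg (b : ℕ) : 0 ≤ Y b := by rw [hY]; positivity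
  have hX_nonneg (a : ℕ) : 0 ≤ X a := by positivity
  have hpointwise (σ : ℕ × ℕ) : pairWeight r ρ u σ ≤ X σ.1 * Y σ.2 + Y σ.1 * X σ.2 := by
    rcases le_total σ.1 σ.2 with h | h
    · rw [pairWeight_of_le h]
      exact le_add_of_nonneg_right (mul_nonneg (hY_nonneg _) (hX_nonneg _))
    · rw [← pairWeight_swap, pairWeight_of_le (σ := σ.swap) h, mul_comm (Y σ.1)]
      exact le_add_of_nonneg_left (mul_nonneg (hX_nonneg _) (hY_nonneg _))
  have hprod : (∑ a ∈ S, X a) * ∑ b ∈ S, Y b ≤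
      geom (r - ρ) * (geom r * (4 ^ r * 2 ^ (-r * u))) :=
    mul_le_mul (sum_two_rpow_neg_le_geom (sub_pos.2 hr) S)
      (sum_two_rpow_neg_tail_le (hρ.trans_lt hr) u S) (Finset.sum_nonneg fun b _ => hY_nonneg b)
      (geom_pos (sub_pos.2 hr)).le
  calc ∑ σ ∈ S ×ˢ S, pairWeight r ρ u σ
      ≤ ∑ σ ∈ S ×ˢ S, (X σ.1 * Y σ.2 + Y σ.1 * X σ.2) := Finset.sum_le_sum fun σ _ => hpointwise σ
    _ = 2 * ((∑ a ∈ S, X a) * ∑ b ∈ S, Y b) := by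
        rw [Finset.sum_add_distrib, Finset.sum_product, Finset.sum_product, ← Finset.sum_mul_sum,
          ← Finset.sum_mul_sum]
        ring
    _ ≤ 2 * (geom (r - ρ) * (geom r * (4 ^ r * 2 ^ (-r * u)))) := by gcongr
    _ = 2 * (geom (r - ρ) * (geom r * 4 ^ r)) * 2 ^ (-r * u) := by ring

end pairWeight

section Product

variable {d : ℕ} {p : ℝ≥0∞} {r B B' : ℝ} {f g : Torus d → ℂ}

lemma eLpNorm_top_block_le (hp : 1 ≤ p) (hf : f ∈ hBlockClass d r p B) (s : Fin d → ℕ) :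
    eLpNorm (block s f) ∞ (torusMeasure d) ≤
      ENNReal.ofReal (B * ∏ j, 8 * (2 : ℝ) ^ (-(r - (1 / p).toReal) * s j)) := by
  refine (eLpNorm_top_le hp (block_mem_trigSpace s (hf.1.integrable hp))).trans ?_
  refine (mul_le_mul_right (hf.2 s) _).trans_eq ?_
  rw [nikolskiiConst, ← ENNReal.ofReal_mul (by positivity), two_rpow_mul_sum, mul_left_comm,
    ← Finset.prod_mul_distrib]
  congr! 3 with j
  rw [mul_assoc, ← Real.rpow_add two_pos]
  ring_nf

lemma eLpNorm_top_partialSum_le (hp : 1 ≤ p) (hr : (1 / p).toReal < r)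
    (hf : f ∈ hBlockClass d r p B) (N : ℕ) :
    eLpNorm (partialSum N f) ∞ (torusMeasure d) ≤
      ENNReal.ofReal (B * ∏ _j : Fin d, 8 * geom (r - (1 / p).toReal)) := by
  have hf_int : Integrable f (torusMeasure d) := hf.1.integrable hp
  rw [partialSum_eq_sum N hf_int]
  refine eLpNorm_sum_piFinset_le le_top (Finset.range (N + 1))
    (fun s => (continuous_block s hf_int).aestronglyMeasurable)
    (w := fun _ a => 8 * (2 : ℝ) ^ (-(r - (1 / p).toReal) * a)) (fun _ _ => by positivity)
    (eLpNorm_top_block_le hp hf) fun _ => ?_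
  rw [← Finset.mul_sum]
  gcongr
  exact sum_two_rpow_neg_le_geom (sub_pos.2 hr) _

lemma tendsto_eLpNorm_one_partialSum_sub (hp : 1 ≤ p) (hf : MemLp f p (torusMeasure d)) :
    Filter.Tendsto (fun N => eLpNorm (partialSum N f - f) 1 (torusMeasure d)) Filter.atTop
      (nhds 0) :=
  tendsto_eLpNorm_partialSum_sub le_rfl ENNReal.one_ne_top (hf.mono_exponent hp)

theorem eLpNorm_top_le_of_mem_hBlockClass (hp : 1 ≤ p) (hr : (1 / p).toReal < r)
    (hf : f ∈ hBlockClass d r p B) :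
    eLpNorm f ∞ (torusMeasure d) ≤
      ENNReal.ofReal (B * ∏ _j : Fin d, 8 * geom (r - (1 / p).toReal)) :=
  eLpNorm_le_of_tendsto_eLpNorm_sub one_ne_zero
    (fun N => (continuous_partialSum N (hf.1.integrable hp)).aestronglyMeasurable) hf.1.1
    (tendsto_eLpNorm_one_partialSum_sub hp hf.1) (eLpNorm_top_partialSum_le hp hr hf)

lemma memLp_mul_of_mem_hBlockClass (hp : 1 ≤ p) (hr : (1 / p).toReal < r)
    (hf : f ∈ hBlockClass d r p B) (hg : MemLp g p (torusMeasure d)) :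
    MemLp (f * g) p (torusMeasure d) :=
  ⟨hf.1.1.mul hg.1, (eLpNorm_mul_le_eLpNorm_top_mul_eLpNorm p f hg.1).trans_lt <|
    ENNReal.mul_lt_top ((eLpNorm_top_le_of_mem_hBlockClass hp hr hf).trans_lt
      ENNReal.ofReal_lt_top) hg.2⟩

lemma tendsto_eLpNorm_partialSum_mul_sub (hp : 1 ≤ p) (hr : (1 / p).toReal < r)
    (hf : f ∈ hBlockClass d r p B) (hg : g ∈ hBlockClass d r p B') :
    Filter.Tendsto
      (fun N => eLpNorm (partialSum N f * partialSum N g - f * g) 1 (torusMeasure d))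
      Filter.atTop (nhds 0) :=
  tendsto_eLpNorm_mul_sub_mul
    (fun N => (continuous_partialSum N (hf.1.integrable hp)).aestronglyMeasurable)
    (fun N => (continuous_partialSum N (hg.1.integrable hp)).aestronglyMeasurable)
    hf.1.1 hg.1.1 ENNReal.ofReal_ne_top ENNReal.ofReal_ne_top
    (eLpNorm_top_partialSum_le hp hr hf) (eLpNorm_top_le_of_mem_hBlockClass hp hr hg)
    (tendsto_eLpNorm_one_partialSum_sub hp hf.1) (tendsto_eLpNorm_one_partialSum_sub hp hg.1)

lemma tendsto_eLpNorm_block_sub (hp : 1 ≤ p) (u : Fin d → ℕ) {F : ℕ → Torus d → ℂ}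
    (hF : ∀ N, Integrable (F N) (torusMeasure d)) (hf : Integrable f (torusMeasure d))
    (hlim : Filter.Tendsto (fun N => eLpNorm (F N - f) p (torusMeasure d)) Filter.atTop
      (nhds 0)) :
    Filter.Tendsto (fun N => eLpNorm (block u (F N) - block u f) p (torusMeasure d))
      Filter.atTop (nhds 0) := by
  have hlim' := ENNReal.Tendsto.const_mul hlim
    (.inr (by finiteness : (24 : ℝ≥0∞) ^ d ≠ ∞))
  rw [mul_zero] at hlim'
  refine tendsto_of_tendsto_of_tendsto_of_le_of_le tendsto_const_nhds hlim' (fun _ => zero_le)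
    fun N => ?_
  have hsub : block u (F N) - block u f = block u (F N - f) :=
    (sub_conv (hF N) hf (continuous_tensor fun j => continuous_blockKernel (u j))).symm
  simpa only [hsub] using eLpNorm_block_le hp u ((hF N).sub hf).1

lemma partialSum_mul_partialSum (N : ℕ) (hf : Integrable f (torusMeasure d))
    (hg : Integrable g (torusMeasure d)) :
    partialSum N f * partialSum N g =
      ∑ σ ∈ Fintype.piFinset fun _ : Fin d => Finset.range (N + 1) ×ˢ Finset.range (N + 1),
        block (fun j => (σ j).1) f * block (fun j => (σ j).2) g := by
  rw [partialSum_eq_sum N hf, partialSum_eq_sum N hg, Finset.sum_mul_sum, ← Finset.sum_product']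
  refine Finset.sum_nbij' (fun s j => (s.1 j, s.2 j))
    (fun σ => (fun j => (σ j).1, fun j => (σ j).2)) (fun s hs => ?_) (fun σ hσ => ?_)
    (fun _ _ => rfl) (fun _ _ => rfl) fun _ _ => rfl
  · simp only [Finset.mem_product, Fintype.mem_piFinset] at hs ⊢
    exact fun j => ⟨hs.1 j, hs.2 j⟩
  · simp only [Finset.mem_product, Fintype.mem_piFinset] at hσ ⊢
    exact ⟨fun j => (hσ j).1, fun j => (hσ j).2⟩

lemma block_mul_eq_zero {s s' u : Fin d → ℕ} {F G : Torus d → ℂ}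
    (hF : F ∈ trigSpace fun j => 2 ^ s j) (hG : G ∈ trigSpace fun j => 2 ^ s' j) {j : Fin d}
    (hj : max (s j) (s' j) + 2 < u j) : block u (F * G) = 0 := by
  refine block_eq_zero_of_mem_trigSpace j (by omega) ?_ (mul_mem_trigSpace hF hG)
  have hs : 2 ^ s j ≤ 2 ^ max (s j) (s' j) := Nat.pow_le_pow_right two_pos (le_max_left _ _)
  have hs' : 2 ^ s' j ≤ 2 ^ max (s j) (s' j) := Nat.pow_le_pow_right two_pos (le_max_right _ _)
  have hu : 2 ^ (max (s j) (s' j) + 3) ≤ 2 ^ u j := Nat.pow_le_pow_right two_pos (by omega)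
  rw [pow_add] at hu
  simp only [Pi.add_apply]
  omega

lemma eLpNorm_block_mul_block_le (hp : 1 ≤ p) (hB : 0 ≤ B) (hf : f ∈ hBlockClass d r p B)
    (hg : g ∈ hBlockClass d r p B') (u : Fin d → ℕ) (σ : Fin d → ℕ × ℕ) :
    eLpNorm (block u (block (fun j => (σ j).1) f * block (fun j => (σ j).2) g)) p
        (torusMeasure d) ≤
      ENNReal.ofReal (B * B' * ∏ j, 192 * pairWeight r (1 / p).toReal (u j) (σ j)) := by
  have hF := block_mem_trigSpace (fun j => (σ j).1) (hf.1.integrable hp)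
  have hG := block_mem_trigSpace (fun j => (σ j).2) (hg.1.integrable hp)
  by_cases! hu : ∃ j, max (σ j).1 (σ j).2 + 2 < u j
  · obtain ⟨j, hj⟩ := hu
    rw [block_mul_eq_zero hF hG hj, eLpNorm_zero]
    exact zero_le
  have hFG : Continuous (block (fun j => (σ j).1) f * block (fun j => (σ j).2) g) :=
    (continuous_of_mem_trigSpace hF).mul (continuous_of_mem_trigSpace hG)
  refine (eLpNorm_block_le hp u hFG.aestronglyMeasurable).trans ?_
  calc 24 ^ d * eLpNorm (block (fun j => (σ j).1) f * block (fun j => (σ j).2) g) p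
        (torusMeasure d)
      ≤ 24 ^ d * (ENNReal.ofReal (nikolskiiConst (1 / p).toReal fun j => min (σ j).1 (σ j).2) *
          (ENNReal.ofReal (B * (2 : ℝ) ^ (-r * ∑ j, ((σ j).1 : ℝ))) *
            ENNReal.ofReal (B' * (2 : ℝ) ^ (-r * ∑ j, ((σ j).2 : ℝ))))) := by
        gcongr
        refine (eLpNorm_mul_le hp hF hG).trans ?_
        gcongr
        · exact le_rfl
        · exact hf.2 _
        · exact hg.2 _
    _ = ENNReal.ofReal (B * B' * ∏ j, 192 * pairWeight r (1 / p).toReal (u j) (σ j)) := by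
        have h24 : (24 : ℝ≥0∞) ^ d = ENNReal.ofReal (∏ _j : Fin d, 24) := by simp
        rw [h24, nikolskiiConst, ← ENNReal.ofReal_mul (by positivity),
          ← ENNReal.ofReal_mul (by positivity), ← ENNReal.ofReal_mul (by positivity),
          two_rpow_mul_sum, two_rpow_mul_sum, mul_mul_mul_comm B,
          mul_left_comm _ (B * B'), mul_left_comm _ (B * B')]
        simp only [← Finset.prod_mul_distrib]
        congr! 3 with j
        rw [pairWeight, if_pos (hu j)]
        ring

/-- The constant, per variable, in the product theorem for the classes defined by blocks; here
`ρ = 1/p`. -/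
def productConst (r ρ : ℝ) : ℝ := 192 * (2 * (geom (r - ρ) * (geom r * 4 ^ r)))

lemma productConst_pos {ρ : ℝ} (hρ : 0 ≤ ρ) (hr : ρ < r) : 0 < productConst r ρ := by
  have := geom_pos (hρ.trans_lt hr)
  have := geom_pos (sub_pos.2 hr)
  unfold productConst
  positivity

lemma eLpNorm_block_partialSum_mul_le (hp : 1 ≤ p) (hr : (1 / p).toReal < r) (hB : 0 ≤ B)
    (hf : f ∈ hBlockClass d r p B) (hg : g ∈ hBlockClass d r p B') (u : Fin d → ℕ) (N : ℕ) :
    eLpNorm (block u (partialSum N f * partialSum N g)) p (torusMeasure d) ≤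
      ENNReal.ofReal (productConst r (1 / p).toReal ^ d * (B * B') *
        2 ^ (-r * ∑ j, (u j : ℝ))) := by
  have hf_int : Integrable f (torusMeasure d) := hf.1.integrable hp
  have hg_int : Integrable g (torusMeasure d) := hg.1.integrable hp
  have hprod (σ : Fin d → ℕ × ℕ) :
      Integrable (block (fun j => (σ j).1) f * block (fun j => (σ j).2) g) (torusMeasure d) :=
    integrable_of_continuous ((continuous_block _ hf_int).mul (continuous_block _ hg_int))
  have hconst : B * B' * ∏ j, productConst r (1 / p).toReal * (2 : ℝ) ^ (-r * u j) =
      productConst r (1 / p).toReal ^ d * (B * B') * 2 ^ (-r * ∑ j, (u j : ℝ)) := by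
    rw [Finset.prod_mul_distrib, Finset.prod_const, Finset.card_univ, Fintype.card_fin,
      two_rpow_mul_sum]
    ring
  rw [partialSum_mul_partialSum N hf_int hg_int, block_eq_conv, sum_conv _ (fun σ _ => hprod σ)
    (continuous_tensor fun j => continuous_blockKernel (u j)), ← hconst]
  refine eLpNorm_sum_piFinset_le hp _
    (fun σ => (continuous_block u (hprod σ)).aestronglyMeasurable)
    (w := fun j a => 192 * pairWeight r (1 / p).toReal (u j) a)
    (fun j a => mul_nonneg (by norm_num) (pairWeight_nonneg _ _))
    (eLpNorm_block_mul_block_le hp hB hf hg u) fun j => ?_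
  rw [← Finset.mul_sum, productConst, mul_assoc]
  gcongr
  exact sum_pairWeight_le ENNReal.toReal_nonneg hr _ _

theorem mul_mem_hBlockClass (hp : 1 ≤ p) (hr : (1 / p).toReal < r) (hB : 0 ≤ B)
    (hf : f ∈ hBlockClass d r p B) (hg : g ∈ hBlockClass d r p B') :
    f * g ∈ hBlockClass d r p (productConst r (1 / p).toReal ^ d * (B * B')) := by
  have hfg := memLp_mul_of_mem_hBlockClass hp hr hf hg.1
  have hfg_int := hfg.integrable hp
  have hpartial (N : ℕ) : Integrable (partialSum N f * partialSum N g) (torusMeasure d) :=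
    integrable_of_continuous ((continuous_partialSum N (hf.1.integrable hp)).mul
      (continuous_partialSum N (hg.1.integrable hp)))
  exact ⟨hfg, fun u => eLpNorm_le_of_tendsto_eLpNorm_sub one_ne_zero
    (fun N => (continuous_block u (hpartial N)).aestronglyMeasurable)
    (continuous_block u hfg_int).aestronglyMeasurable
    (tendsto_eLpNorm_block_sub le_rfl u hpartial hfg_int
      (tendsto_eLpNorm_partialSum_mul_sub hp hr hf hg))
    (eLpNorm_block_partialSum_mul_le hp hr hB hf hg u)⟩

theorem mul_mem_hClassOrder (hp : 1 ≤ p) (hr : (1 / p).toReal < r) {l : ℕ} (hl : r < l)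
    (hB : 0 ≤ B) (hf : f ∈ hClassOrder d r p l B) (hg : g ∈ hClassOrder d r p l B') :
    f * g ∈ hClassOrder d r p l (bernsteinConst r l ^ d * (productConst r (1 / p).toReal ^ d *
      ((24 * 56 ^ l) ^ d * B * ((24 * 56 ^ l) ^ d * B')))) :=
  hBlockClass_subset_hClassOrder hp (ENNReal.toReal_nonneg.trans_lt hr) hl _ <|
    mul_mem_hBlockClass hp hr (by positivity) (hClassOrder_subset_hBlockClass hp r l B hf)
      (hClassOrder_subset_hBlockClass hp r l B' hg)

end Product

section QuasiAlgebra

lemma quasiAlgebraWith_of_mul_mem {X : Type*} {W : ℝ → Set (X → ℂ)}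
    (hsmul : ∀ (c : ℂ) (B : ℝ), ∀ f ∈ W B, c • f ∈ W (‖c‖ * B)) {B : ℝ} (hB : 0 < B)
    (hmul : ∀ f ∈ W 1, ∀ g ∈ W 1, f * g ∈ W B) : QuasiAlgebraWith (W 1) B := by
  intro f hf g hg
  have hmem := hsmul (B : ℂ)⁻¹ B _ (hmul f hf g hg)
  rw [norm_inv, Complex.norm_of_nonneg hB.le, inv_mul_cancel₀ hB.ne'] at hmem
  convert hmem using 1
  ext x
  exact div_eq_inv_mul _ _

variable {d : ℕ} {p : ℝ≥0∞} {r : ℝ}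

lemma eLpNorm_smul_le_ofReal {α : Type*} [MeasurableSpace α] {μ : Measure α} (c : ℂ) {B b : ℝ}
    {f : α → ℂ} (hf : eLpNorm f p μ ≤ ENNReal.ofReal (B * b)) :
    eLpNorm (c • f) p μ ≤ ENNReal.ofReal (‖c‖ * B * b) := by
  rw [eLpNorm_const_smul, mul_assoc, ENNReal.ofReal_mul (norm_nonneg c), ofReal_norm]
  gcongr

lemma smul_mem_hClassOrder {l : ℕ} (c : ℂ) (B : ℝ) :
    ∀ f ∈ hClassOrder d r p l B, c • f ∈ hClassOrder d r p l (‖c‖ * B) := by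
  refine fun f hf => ⟨hf.1.const_smul c, fun e t => ?_⟩
  have hdiff : mixedDiff l t e (c • f) = c • mixedDiff l t e f :=
    mixedDiff_rel (R := fun F f => F = c • f)
      (fun F f h hF => by rw [hF, fwdDiff_const_smul]) rfl l t e
  rw [hdiff]
  exact eLpNorm_smul_le_ofReal c (hf.2 e t)

lemma smul_mem_hBlockClass (c : ℂ) (B : ℝ) :
    ∀ f ∈ hBlockClass d r p B, c • f ∈ hBlockClass d r p (‖c‖ * B) := by
  refine fun f hf => ⟨hf.1.const_smul c, fun s => ?_⟩
  rw [block_eq_conv, smul_conv]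
  exact eLpNorm_smul_le_ofReal c (hf.2 s)

end QuasiAlgebra

end MixedSmoothness

end

open MixedSmoothness in
theorem proposition5p1_general (d : ℕ) (p : ENNReal) (hp : 1 ≤ p) (r : ℝ)
    (hr : (1 / p).toReal < r) (l : ℕ) (hl : r < l) :
    (∃ B : ℝ, 0 < B ∧
      (∀ f ∈ hClassOrder d r p l 1, ∀ g ∈ hClassOrder d r p l 1,
        (fun x => f x * g x) ∈ hClassOrder d r p l B) ∧
      QuasiAlgebraWith (hClassOrder d r p l 1) B) ∧
    (∃ B : ℝ, 0 < B ∧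
      (∀ f ∈ hBlockClass d r p 1, ∀ g ∈ hBlockClass d r p 1,
        (fun x => f x * g x) ∈ hBlockClass d r p B) ∧
      QuasiAlgebraWith (hBlockClass d r p 1) B) := by
  have hρ : 0 ≤ (1 / p).toReal := ENNReal.toReal_nonneg
  have hproduct := productConst_pos hρ hr
  have hbernstein := bernsteinConst_pos (hρ.trans_lt hr) hl
  have hmul := fun f (hf : f ∈ hClassOrder d r p l 1) g (hg : g ∈ hClassOrder d r p l 1) =>
    mul_mem_hClassOrder hp hr hl zero_le_one hf hg
  have hmul' := fun f (hf : f ∈ hBlockClass d r p 1) g (hg : g ∈ hBlockClass d r p 1) =>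
    mul_mem_hBlockClass hp hr zero_le_one hf hg
  exact ⟨⟨_, by positivity, hmul, quasiAlgebraWith_of_mul_mem smul_mem_hClassOrder
      (by positivity) hmul⟩,
    ⟨_, by positivity, hmul', quasiAlgebraWith_of_mul_mem smul_mem_hBlockClass
      (by positivity) hmul'⟩⟩

theorem proposition5p1 (d : ℕ) (hd : 1 ≤ d) (p : ENNReal) (hp : 1 ≤ p) (r : ℝ)
    (hr : (1 / p).toReal < r) :
    (∃ B : ℝ, 0 < B ∧
      (∀ f ∈ MixedSmoothness.hClass d r p 1, ∀ g ∈ MixedSmoothness.hClass d r p 1,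
        (fun x => f x * g x) ∈ MixedSmoothness.hClass d r p B) ∧
      MixedSmoothness.QuasiAlgebraWith (MixedSmoothness.hClass d r p 1) B) ∧
    (∃ B : ℝ, 0 < B ∧
      (∀ f ∈ MixedSmoothness.hBlockClass d r p 1, ∀ g ∈ MixedSmoothness.hBlockClass d r p 1,
        (fun x => f x * g x) ∈ MixedSmoothness.hBlockClass d r p B) ∧
      MixedSmoothness.QuasiAlgebraWith (MixedSmoothness.hBlockClass d r p 1) B) :=
  proposition5p1_general d p hp r hr (⌊r⌋₊ + 1) (by exact_mod_cast Nat.lt_floor_add_one r)
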